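/- For $\lambda\in\mathbb{C}\setminus\{0\}$ let $f_\lambda:\mathbb{C}\to\mathbb{C}$, $f_\lambda(z)=\lambda e^z$. The Julia set $J(f_\lambda)$ is the set of points of $\mathbb{C}$ that have no neighbourhood on which the iterates $(f_\lambda^n)_{n\ge 0}$ form a normal family (convergence to $\infty$ being allowed). For $z\in\mathbb{C}$ let $\omega(z)\subset\widehat{\mathbb{C}}=\mathbb{C}\cup\{\infty\}$ be the $\omega$-limit set of $z$ in the Riemann sphere, and let $\mathcal{P}(f_\lambda)=\{\infty\}\cup\overline{\{f_\lambda^n(0):n\ge 0\}}$ be the post-singular set. Suppose that $\lambda\neq 0$ satisfies (i) $J(f_\lambda)=\mathbb{C}$; (ii) the forward orbit $\{f_\lambda^n(0):n\ge 0\}$ is bounded in $\mathbb{C}$; (iii) the set of $z\in\mathbb{C}$ with $\omega(z)\not\subset\mathcal{P}(f_\lambda)$ has positive Lebesgue measure. Then $f_\lambda$ has a nonzero $\sigma$-finite invariant Borel measure $\mu$ (that is, $\mu(f_\lambda^{-1}(A))=\mu(A)$ for every Borel set $A\subset\mathbb{C}$) which is absolutely continuous with respect to Lebesgue measure on $\mathbb{C}$,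 but $f_\lambda$ has no invariant Borel probability measure that is absolutely continuous with respect to Lebesgue measure. Moreover, $\lambda=2\pi i$ satisfies (i), (ii) and (iii); in particular $z\mapsto 2\pi i\,e^z$ has a $\sigma$-finite absolutely continuous invariant measure but no absolutely continuous invariant probability measure. -/

import Mathlib

open MeasureTheory Filter Topology

namespace ExpDynamics

/-- The entire map `z ↦ lam * exp z`. -/
noncomputable def expMap (lam : ℂ) (z : ℂ) : ℂ := lam * Complex.exp z

/-- The sequence `F` of complex functions converges to `∞` locally uniformly on the open set `U`,
i.e. uniformly on compact subsets of `U`. -/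
def TendstoInftyLocallyUniformlyOn (F : ℕ → ℂ → ℂ) (U : Set ℂ) : Prop :=
  ∀ K ⊆ U, IsCompact K → ∀ R : ℝ, ∀ᶠ n in atTop, ∀ z ∈ K, R < ‖F n z‖

/-- The iterates of `f` form a normal family on the open set `U`: every sequence of iterates has a
subsequence that converges locally uniformly on `U`, either to a finite function
(holomorphic when `f` is) or to `∞`. -/
def IteratesNormalOn (f : ℂ → ℂ) (U : Set ℂ) : Prop :=
  ∀ n : ℕ → ℕ, ∃ k : ℕ → ℕ, StrictMono k ∧
    ((∃ g : ℂ → ℂ, TendstoLocallyUniformlyOn (fun j => f^[n (k j)]) g atTop U) ∨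
      TendstoInftyLocallyUniformlyOn (fun j => f^[n (k j)]) U)

/-- The Fatou set: the points with a neighbourhood on which the iterates form a normal family. -/
def fatouSet (f : ℂ → ℂ) : Set ℂ :=
  {z | ∃ U : Set ℂ, IsOpen U ∧ z ∈ U ∧ IteratesNormalOn f U}

/-- The Julia set: the complement of the Fatou set in the plane. -/
def juliaSet (f : ℂ → ℂ) : Set ℂ := (fatouSet f)ᶜ

/-- The forward orbit of `z`, including `z` itself. -/
def forwardOrbit (f : ℂ → ℂ) (z : ℂ) : Set ℂ := Set.range fun n : ℕ => f^[n] z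

/-- The `ω`-limit set of `z`, taken in the Riemann sphere `OnePoint ℂ`. -/
def omegaLimitSet (f : ℂ → ℂ) (z : ℂ) : Set (OnePoint ℂ) :=
  omegaLimit atTop (fun (n : ℕ) (w : ℂ) => ((f^[n] w : ℂ) : OnePoint ℂ)) {z}

/-- The post-singular set of `z ↦ lam * exp z` (whose only finite singular value is `0`):
the closure of the orbit of `0`, together with `∞`. -/
def postSingularSet (lam : ℂ) : Set (OnePoint ℂ) :=
  insert OnePoint.infty
    ((fun w : ℂ => (w : OnePoint ℂ)) '' closure (forwardOrbit (expMap lam) 0))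

/-- The standing conditions on the parameter: `lam ≠ 0`, the Julia set is the whole plane, the orbit
of `0` is bounded, and the points whose `ω`-limit set is not contained in the post-singular set
have positive Lebesgue measure. -/
structure Admissible (lam : ℂ) : Prop where
  ne_zero : lam ≠ 0
  julia_eq : juliaSet (expMap lam) = Set.univ
  orbit_bounded : Bornology.IsBounded (forwardOrbit (expMap lam) 0)
  pos_measure : 0 < volume {z : ℂ | ¬ omegaLimitSet (expMap lam) z ⊆ postSingularSet lam}

/-- `μ` is a (nonzero) `f`-invariant measure, absolutely continuous with respect to Lebesgue
measure. -/
structure IsACInvariant (f : ℂ → ℂ) (μ : Measure ℂ) : Prop where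
  ne_zero : μ ≠ 0
  ac : μ ≪ volume
  invariant : MeasurePreserving f μ μ

end ExpDynamics

/-!
Write `f z = lam * exp z` and let `P` be the closure of the orbit of `0`. On a disc disjoint from
`P` all inverse branches of all iterates exist. They are injective, so by Koebe's theorem they have
bounded distortion; the version needed here follows from Bloch's theorem, because the image of a
branch of `log (φ - w)` with `φ` injective never meets its translate by `2πi`.

*Invariant measure.* Apply the iterates of the transfer operator `L` to an integrable density, sum
the first `n` results, normalise the sums at a point off `P` and take the limit inferior. By
distortion the limit `v` is finite off `P`, and by Fatou's lemma `L v ≤ v`. On the set of points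
that visit a suitable disc infinitely often, which has positive measure by (iii), recurrence turns
this into `L v = v`.

*No invariant probability.* The complement of `P` is connected because `J = ℂ` and `P` is bounded,
and density points show that almost every orbit is recurrent. An invariant probability would make
`v` integrable, and `v` is positive off `P`. Translations by multiples of `πi / 2` rotate the
values of `f` and, far to the right, change `v` only by a bounded factor; so the mass of
`Re z > log t` is at most a constant times the mass of `Re z > t`, and of `Re z < -t`. Iterating the
first bound, these masses are at least a constant times `1 / t`. On the other hand a point with
`Re z < -t` is mapped so close to `0` that it follows the bounded orbit of `0` for a time comparable
to `t`; by invariance the masses of `Re z < -t` have a finite sum over `t`, whereas the harmonic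
series diverges.

*The parameter `2πi`.* Here `P = {0, 2πi}` and `2πi` is a repelling fixed point. Escaping points
have measure zero, again by density points, and an orbit that neither escapes nor lands on `2πi`
accumulates off `P`. Along the returns to such a limit point the derivatives of the iterates tend
to infinity, so the iterates are not normal there.
-/

namespace ExpDynamics

open Metric Set

/-! ### Distortion of inverse branches -/

lemma exists_hasDerivAt_log {U : Set ℂ} {g : ℂ → ℂ} (hUc : IsSimplyConnected U) (hUo : IsOpen U)
    (hg : DifferentiableOn ℂ g U) (h0 : ∀ x ∈ U, g x ≠ 0) :
    ∃ l : ℂ → ℂ, (∀ x ∈ U, HasDerivAt l (deriv g x / g x) x) ∧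
      ∀ x ∈ U, Complex.exp (l x) = g x := by
  obtain ⟨l, hlc, hl⟩ := Complex.exists_continuousOn_eqOn_exp_comp hUc hUo hg.continuousOn
    (fun ⟨x, hx, h⟩ ↦ h0 x hx h)
  refine ⟨l, fun x hx ↦ ?_, hl⟩
  have hUx := hUo.mem_nhds hx
  have hlx : Complex.exp (l x) = g x := hl hx
  have hexp : HasStrictDerivAt Complex.exp (g x) (l x) := hlx ▸ Complex.hasStrictDerivAt_exp (l x)
  have hinv := (hexp.to_localInverse (h0 x hx)).hasDerivAt
  rw [hlx] at hinv
  have hcomp := hinv.comp x (hg.differentiableAt hUx).hasDerivAt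
  rw [inv_mul_eq_div] at hcomp
  refine hcomp.congr_of_eventuallyEq ?_
  have hleft := (hlc.continuousAt hUx).eventually
    (hexp.eventually_left_inverse (h0 x hx))
  filter_upwards [hleft, hUx] with y hy hyU
  rw [Function.comp_apply, ← hl hyU, Function.comp_apply, hy]

lemma isSimplyConnected_ball {a : ℂ} {R : ℝ} (hR : 0 < R) : IsSimplyConnected (ball a R) := by
  have := (convex_ball a R).contractibleSpace (nonempty_ball.2 hR)
  exact inferInstanceAs (SimplyConnectedSpace (ball a R))

-- The point `p` maximises `‖g z‖ * (R / 2 - dist z a)`, and `t` is half of `R / 2 - dist p a`.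
lemma exists_ball_norm_le_two_mul {X E : Type*} [PseudoMetricSpace X] [ProperSpace X]
    [NormedAddCommGroup E] {g : X → E} {a : X} {R : ℝ} (hR : 0 < R)
    (hg : ContinuousOn g (ball a R)) (ha : g a ≠ 0) :
    ∃ p t, 0 < t ∧ ball p t ⊆ ball a R ∧ ‖g a‖ * R ≤ 4 * (‖g p‖ * t) ∧
      ∀ z ∈ ball p t, ‖g z‖ ≤ 2 * ‖g p‖ := by
  have hsub : closedBall a (R / 2) ⊆ ball a R := closedBall_subset_ball (by linarith)
  obtain ⟨p, -, hmax⟩ := (isCompact_closedBall a (R / 2)).exists_isMaxOn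
    ⟨a, mem_closedBall_self (by linarith)⟩
    (f := fun z ↦ ‖g z‖ * (R / 2 - dist z a)) ((hg.mono hsub).norm.mul (by fun_prop))
  have hmax' : ∀ z ∈ closedBall a (R / 2),
      ‖g z‖ * (R / 2 - dist z a) ≤ ‖g p‖ * (R / 2 - dist p a) := fun z hz ↦ hmax hz
  obtain ⟨t, ht⟩ : ∃ t, R / 2 - dist p a = 2 * t := ⟨_, (mul_div_cancel₀ _ two_ne_zero).symm⟩
  rw [ht] at hmax'
  have hcenter : ‖g a‖ * R ≤ 4 * (‖g p‖ * t) := by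
    have := hmax' a (mem_closedBall_self (by linarith))
    rw [dist_self, sub_zero] at this
    linarith
  have ht0 : 0 < t := by
    have hpos : 0 < ‖g a‖ * R := mul_pos (norm_pos_iff.2 ha) hR
    exact pos_of_mul_pos_right (by linarith : 0 < ‖g p‖ * t) (norm_nonneg _)
  have hdist : ∀ z ∈ ball p t, t ≤ R / 2 - dist z a := fun z hz ↦ by
    linarith [dist_triangle z p a, mem_ball.1 hz]
  have hball : ball p t ⊆ closedBall a (R / 2) := fun z hz ↦ by
    rw [mem_closedBall]; linarith [hdist z hz]
  refine ⟨p, t, ht0, hball.trans hsub, hcenter, fun z hz ↦ le_of_mul_le_mul_right ?_ ht0⟩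
  calc ‖g z‖ * t ≤ ‖g z‖ * (R / 2 - dist z a) := by gcongr; exact hdist z hz
    _ ≤ ‖g p‖ * (2 * t) := hmax' z (hball hz)
    _ = 2 * ‖g p‖ * t := by ring

lemma norm_sub_ge_of_norm_deriv_le {f : ℂ → ℂ} {p z : ℂ} {t : ℝ}
    (hf : DifferentiableOn ℂ f (ball p t)) (hbd : ∀ z ∈ ball p t, ‖deriv f z‖ ≤ 2 * ‖deriv f p‖)
    (hz : dist z p ≤ t / 6) (ht : 0 < t) :
    ‖deriv f p‖ / 2 * dist z p ≤ ‖f z - f p‖ := by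
  have hsub : closedBall p (t / 6) ⊆ ball p t := closedBall_subset_ball (by linarith)
  have hmaps : MapsTo (deriv f) (ball p t) (closedBall (deriv f p) (3 * ‖deriv f p‖)) := by
    intro w hw
    rw [mem_closedBall, dist_eq_norm]
    linarith [norm_sub_le (deriv f w) (deriv f p), hbd w hw]
  have hschwarz : ∀ w ∈ closedBall p (t / 6), ‖deriv f w - deriv f p‖ ≤ ‖deriv f p‖ / 2 := by
    intro w hw
    have hw' := Complex.dist_le_div_mul_dist_of_mapsTo_ball (hf.deriv isOpen_ball) hmaps (hsub hw)
    rw [mem_closedBall] at hw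
    calc ‖deriv f w - deriv f p‖ ≤ 3 * ‖deriv f p‖ / t * dist w p := by
          rwa [← dist_eq_norm]
      _ ≤ 3 * ‖deriv f p‖ / t * (t / 6) := by gcongr
      _ = ‖deriv f p‖ / 2 := by field_simp; ring
  have hlinear := (convex_closedBall p (t / 6)).norm_image_sub_le_of_norm_hasDerivWithin_le
    (f := fun w ↦ f w - deriv f p * w) (f' := fun w ↦ deriv f w - deriv f p)
    (fun w hw ↦ ((hf.differentiableAt (isOpen_ball.mem_nhds (hsub hw))).hasDerivAt.sub
      (hasDerivAt_const_mul (deriv f p))).hasDerivWithinAt)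
    hschwarz (mem_closedBall_self (by positivity)) (mem_closedBall.2 hz)
  have htri := norm_sub_le (f z - f p) (f z - deriv f p * z - (f p - deriv f p * p))
  have hlin : f z - f p - (f z - deriv f p * z - (f p - deriv f p * p)) =
      deriv f p * (z - p) := by ring
  rw [hlin, norm_mul] at htri
  rw [dist_eq_norm]
  linarith

lemma ball_subset_image_of_norm_deriv_le {f : ℂ → ℂ} {p : ℂ} {t : ℝ} (ht : 0 < t)
    (hf : DifferentiableOn ℂ f (ball p t)) (hp : deriv f p ≠ 0)
    (hbd : ∀ z ∈ ball p t, ‖deriv f z‖ ≤ 2 * ‖deriv f p‖) :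
    ball (f p) (‖deriv f p‖ * t / 24) ⊆ f '' ball p t := by
  have hsub : closedBall p (t / 6) ⊆ ball p t := closedBall_subset_ball (by linarith)
  have hlow : ∀ z ∈ sphere p (t / 6), ‖deriv f p‖ * t / 12 ≤ ‖f z - f p‖ := by
    intro z hz
    have := norm_sub_ge_of_norm_deriv_le hf hbd hz.le ht
    rw [mem_sphere.1 hz] at this
    linarith
  have hcov := DiffContOnCl.ball_subset_image_closedBall
    ((hf.mono hsub).diffContOnCl_ball subset_rfl) (by positivity) hlow
    (((hf.differentiableAt (ball_mem_nhds p ht)).hasDerivAt.eventually_ne hp).frequently.filter_mono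
      nhdsWithin_le_nhds)
  rw [div_div] at hcov
  norm_num only at hcov
  exact hcov.trans (image_mono hsub)

-- Bloch's theorem, with the non-optimal constant `1 / 96`.
theorem exists_ball_subset_image_ball {f : ℂ → ℂ} {a : ℂ} {R : ℝ} (hR : 0 < R)
    (hf : DifferentiableOn ℂ f (ball a R)) :
    ∃ p ∈ ball a R, ball (f p) (‖deriv f a‖ * R / 96) ⊆ f '' ball a R := by
  rcases eq_or_ne (deriv f a) 0 with h0 | h0
  · exact ⟨a, mem_ball_self hR, by simp [h0]⟩
  obtain ⟨p, t, ht, hsub, hle, hbd⟩ :=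
    exists_ball_norm_le_two_mul hR (hf.deriv isOpen_ball).continuousOn h0
  have hp : deriv f p ≠ 0 := by
    intro h
    rw [h, norm_zero, zero_mul, mul_zero] at hle
    exact hle.not_gt (mul_pos (norm_pos_iff.2 h0) hR)
  refine ⟨p, hsub (mem_ball_self ht), ?_⟩
  calc ball (f p) (‖deriv f a‖ * R / 96) ⊆ ball (f p) (‖deriv f p‖ * t / 24) :=
        ball_subset_ball (by linarith)
    _ ⊆ f '' ball p t := ball_subset_image_of_norm_deriv_le ht (hf.mono hsub) hp hbd
    _ ⊆ f '' ball a R := image_mono hsub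

lemma norm_deriv_mul_le_of_ne_add {f : ℂ → ℂ} {a c : ℂ} {R : ℝ} (hR : 0 < R)
    (hf : DifferentiableOn ℂ f (ball a R))
    (hne : ∀ x ∈ ball a R, ∀ y ∈ ball a R, f x ≠ f y + c) :
    ‖deriv f a‖ * R ≤ 96 * ‖c‖ := by
  by_contra! hbig
  obtain ⟨p, hp, hcov⟩ := exists_ball_subset_image_ball hR hf
  obtain ⟨x, hx, hxc⟩ := hcov (show f p + c ∈ _ by
    rw [mem_ball, dist_eq_norm, add_sub_cancel_left]; linarith)
  exact hne x hx p hp hxc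

lemma norm_deriv_mul_le_of_ne_add_two_pi_I {f : ℂ → ℂ} {a : ℂ} {R : ℝ} (hR : 0 < R)
    (hf : DifferentiableOn ℂ f (ball a R))
    (hne : ∀ x ∈ ball a R, ∀ y ∈ ball a R, f x ≠ f y + 2 * Real.pi * Complex.I) :
    ‖deriv f a‖ * R ≤ 640 := by
  refine (norm_deriv_mul_le_of_ne_add hR hf hne).trans ?_
  have : ‖(2 * Real.pi * Complex.I : ℂ)‖ = 2 * Real.pi := by simp [abs_of_pos Real.pi_pos]
  rw [this]
  linarith [Real.pi_lt_d2]

-- Koebe's covering theorem, with `1 / 640` in place of `1 / 4`: if `φ` omits `w`, then the image of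
-- a branch of `log (φ - w)` is disjoint from its translate by `2πi`.
lemma ball_subset_image_ball_of_injOn {φ : ℂ → ℂ} {a : ℂ} {R : ℝ} (hR : 0 < R)
    (hφ : DifferentiableOn ℂ φ (ball a R)) (hinj : InjOn φ (ball a R)) :
    ball (φ a) (‖deriv φ a‖ * R / 640) ⊆ φ '' ball a R := by
  intro w hw
  by_contra hn
  have h0 : ∀ x ∈ ball a R, φ x - w ≠ 0 := fun x hx h ↦ hn ⟨x, hx, sub_eq_zero.1 h⟩
  obtain ⟨l, hl, hle⟩ :=
    exists_hasDerivAt_log (isSimplyConnected_ball hR) isOpen_ball (hφ.sub_const w) h0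
  have ha : a ∈ ball a R := mem_ball_self hR
  have hne : ∀ x ∈ ball a R, ∀ y ∈ ball a R, l x ≠ l y + 2 * Real.pi * Complex.I := by
    intro x hx y hy h
    have he : Complex.exp (l x) = Complex.exp (l y) := by
      rw [h, Complex.exp_add, Complex.exp_two_pi_mul_I, mul_one]
    rw [hle x hx, hle y hy, sub_left_inj] at he
    obtain rfl := hinj hx hy he
    exact Complex.two_pi_I_ne_zero (left_eq_add.1 h)
  have hbloch := norm_deriv_mul_le_of_ne_add_two_pi_I hR
    (fun x hx ↦ (hl x hx).differentiableAt.differentiableWithinAt) hne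
  rw [(hl a ha).deriv, deriv_sub_const, norm_div, div_mul_eq_mul_div, div_le_iff₀
    (norm_pos_iff.2 (h0 a ha))] at hbloch
  rw [mem_ball, dist_comm, dist_eq_norm] at hw
  linarith

/-- `φ` is a holomorphic inverse branch of `F` on the disc `ball a R`. -/
structure IsInverseBranch (F φ : ℂ → ℂ) (a : ℂ) (R : ℝ) : Prop where
  diff : DifferentiableOn ℂ φ (ball a R)
  right_inv : ∀ x ∈ ball a R, F (φ x) = x

namespace IsInverseBranch

variable {F φ : ℂ → ℂ} {a : ℂ} {R : ℝ}

lemma mono (h : IsInverseBranch F φ a R) {b : ℂ} {S : ℝ} (hs : ball b S ⊆ ball a R) :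
    IsInverseBranch F φ b S :=
  ⟨h.diff.mono hs, fun x hx ↦ h.right_inv x (hs hx)⟩

lemma injOn (h : IsInverseBranch F φ a R) : InjOn φ (ball a R) :=
  LeftInvOn.injOn h.right_inv

lemma hasDerivAt (h : IsInverseBranch F φ a R) {x : ℂ} (hx : x ∈ ball a R) :
    HasDerivAt φ (deriv φ x) x :=
  (h.diff.differentiableAt (isOpen_ball.mem_nhds hx)).hasDerivAt

lemma deriv_mul (h : IsInverseBranch F φ a R) (hF : Differentiable ℂ F) {x : ℂ}
    (hx : x ∈ ball a R) : deriv F (φ x) * deriv φ x = 1 := by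
  have hcomp : HasDerivAt (F ∘ φ) (deriv F (φ x) * deriv φ x) x :=
    (hF (φ x)).hasDerivAt.comp x (h.hasDerivAt hx)
  have hid : HasDerivAt (F ∘ φ) 1 x := (hasDerivAt_id x).congr_of_eventuallyEq <| by
    filter_upwards [isOpen_ball.mem_nhds hx] with y hy using h.right_inv y hy
  exact hcomp.unique hid

lemma deriv_ne_zero (h : IsInverseBranch F φ a R) (hF : Differentiable ℂ F) {x : ℂ}
    (hx : x ∈ ball a R) : deriv φ x ≠ 0 :=
  right_ne_zero_of_mul_eq_one (h.deriv_mul hF hx)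

lemma norm_deriv_mul (h : IsInverseBranch F φ a R) (hF : Differentiable ℂ F) {x : ℂ}
    (hx : x ∈ ball a R) : ‖deriv F (φ x)‖ * ‖deriv φ x‖ = 1 := by
  rw [← norm_mul, h.deriv_mul hF hx, norm_one]

-- Otherwise `F` would map a disc of radius `2 * R * ‖deriv φ a‖` about `φ a` into `ball a R`,
-- contradicting the Schwarz lemma as its derivative at `φ a` is `(deriv φ a)⁻¹`.
lemma exists_omitted (h : IsInverseBranch F φ a R) (hF : Differentiable ℂ F) (hR : 0 < R) :
    ∃ w, (∀ x ∈ ball a R, φ x ≠ w) ∧ ‖φ a - w‖ ≤ 2 * R * ‖deriv φ a‖ := by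
  by_contra! hcon
  have ha : a ∈ ball a R := mem_ball_self hR
  have hd : 0 < ‖deriv φ a‖ := norm_pos_iff.2 (h.deriv_ne_zero hF ha)
  have hmaps : MapsTo F (ball (φ a) (2 * R * ‖deriv φ a‖)) (closedBall (F (φ a)) R) := by
    intro w hw
    by_contra hn
    have hw' : ∀ x ∈ ball a R, φ x ≠ w := by
      rintro x hx rfl
      rw [h.right_inv x hx, h.right_inv a ha] at hn
      exact hn (ball_subset_closedBall hx)
    rw [mem_ball, dist_comm, dist_eq_norm] at hw
    exact (hcon w hw').not_gt hw
  have hschwarz :=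
    Complex.norm_deriv_le_div_of_mapsTo_ball hF.differentiableOn hmaps (by positivity)
  rw [le_div_iff₀ (by positivity)] at hschwarz
  nlinarith [h.norm_deriv_mul hF ha]

end IsInverseBranch

section InjectiveSquare

variable {s : ℂ → ℂ} {a : ℂ} {R : ℝ}

-- If `s x` is close to `-s a`, then `-s x = s y` for some `y` by the covering theorem; hence
-- `x = y` and `s x = 0`.
lemma norm_add_ge_of_injOn_sq (hR : 0 < R) (hs : DifferentiableOn ℂ s (ball a R))
    (h0 : ∀ x ∈ ball a R, s x ≠ 0) (hinj : InjOn (fun x ↦ s x ^ 2) (ball a R)) {x : ℂ}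
    (hx : x ∈ ball a R) : ‖deriv s a‖ * R / 640 ≤ ‖s x + s a‖ := by
  have hs_inj : InjOn s (ball a R) := fun x hx y hy hxy ↦ hinj hx hy (by simp only [hxy])
  by_contra! hlt
  obtain ⟨y, hy, hyx⟩ := ball_subset_image_ball_of_injOn hR hs hs_inj
    (show -s x ∈ _ by
      rwa [mem_ball, dist_comm, dist_eq_norm, sub_neg_eq_add, add_comm])
  obtain rfl := hinj hy hx (by simp only [hyx, neg_sq])
  exact h0 y hy (self_eq_neg.1 hyx)

-- Schwarz's lemma for `s a / (s + s a)`, which takes the value `1 / 2` at `a`.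
lemma norm_le_of_norm_add_ge (hR : 0 < R) (hs : DifferentiableOn ℂ s (ball a R))
    (ha : s a ≠ 0) (hfar : ∀ x ∈ ball a R, ‖s a‖ ≤ 2560 * ‖s x + s a‖) {z : ℂ}
    (hz : z ∈ closedBall a (R / 12800)) : ‖s z‖ ≤ 5 * ‖s a‖ := by
  have hhalf : ‖(1 / 2 : ℂ)‖ = 1 / 2 := by norm_num
  have hne : ∀ x ∈ ball a R, s x + s a ≠ 0 := fun x hx h ↦ by
    have := hfar x hx
    rw [h, norm_zero, mul_zero] at this
    exact ha (norm_le_zero_iff.1 this)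
  set G : ℂ → ℂ := fun x ↦ s a / (s x + s a) with hG
  have hGd : DifferentiableOn ℂ G (ball a R) :=
    (differentiableOn_const _).div (hs.add_const _) hne
  have hGa : G a = 1 / 2 := by
    simp only [hG]; field_simp; norm_num
  have hGmaps : MapsTo G (ball a R) (closedBall (G a) 2561) := by
    intro x hx
    have hGx : ‖G x‖ ≤ 2560 := by
      rw [hG, norm_div]
      exact div_le_of_le_mul₀ (norm_nonneg _) (by norm_num) (hfar x hx)
    rw [mem_closedBall, dist_eq_norm, hGa]
    linarith [norm_sub_le (G x) (1 / 2)]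
  have hzR : z ∈ ball a R := closedBall_subset_ball (by linarith) hz
  have hGz : ‖1 / 2 - G z‖ ≤ 1 / 4 := by
    rw [mem_closedBall] at hz
    calc ‖1 / 2 - G z‖ = dist (G z) (G a) := by rw [hGa, dist_comm, dist_eq_norm]
      _ ≤ 2561 / R * dist z a := Complex.dist_le_div_mul_dist_of_mapsTo_ball hGd hGmaps hzR
      _ ≤ 2561 / R * (R / 12800) := by gcongr
      _ = 2561 / 12800 := by field_simp
      _ ≤ 1 / 4 := by norm_num
  have hGlow : 1 / 4 ≤ ‖G z‖ := by
    have := norm_sub_norm_le (1 / 2 : ℂ) (1 / 2 - G z)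
    rw [sub_sub_cancel] at this
    linarith
  have hsum : ‖s z + s a‖ ≤ 4 * ‖s a‖ := by
    rw [hG, norm_div, le_div_iff₀ (norm_pos_iff.2 (hne z hzR))] at hGlow
    linarith
  have := norm_sub_le (s z + s a) (s a)
  rw [add_sub_cancel_right] at this
  linarith

end InjectiveSquare

namespace IsInverseBranch

variable {F φ : ℂ → ℂ} {a : ℂ} {R : ℝ}

lemma exists_sqrt (h : IsInverseBranch F φ a R) (hR : 0 < R) {w : ℂ}
    (hw : ∀ x ∈ ball a R, φ x ≠ w) :
    ∃ s : ℂ → ℂ, (∀ x ∈ ball a R, HasDerivAt s (s x * (deriv φ x / (φ x - w) / 2)) x) ∧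
      (∀ x ∈ ball a R, s x ^ 2 = φ x - w) ∧ ∀ x, s x ≠ 0 := by
  obtain ⟨l, hl, hle⟩ := exists_hasDerivAt_log (isSimplyConnected_ball hR) isOpen_ball
    (h.diff.sub_const w) (fun x hx ↦ sub_ne_zero.2 (hw x hx))
  refine ⟨fun x ↦ Complex.exp (l x / 2), fun x hx ↦ ?_, fun x hx ↦ ?_,
    fun x ↦ Complex.exp_ne_zero _⟩
  · simpa only [deriv_sub_const] using ((hl x hx).div_const 2).cexp
  · rw [← hle x hx, ← Complex.exp_nat_mul, Nat.cast_ofNat, mul_div_cancel₀ _ two_ne_zero]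

lemma norm_sub_le (h : IsInverseBranch F φ a R) (hF : Differentiable ℂ F) (hR : 0 < R) {z : ℂ}
    (hz : z ∈ closedBall a (R / 12800)) : ‖φ z - φ a‖ ≤ 52 * R * ‖deriv φ a‖ := by
  have ha : a ∈ ball a R := mem_ball_self hR
  have hzR : z ∈ ball a R := closedBall_subset_ball (by linarith) hz
  obtain ⟨w, hw, hwa⟩ := h.exists_omitted hF hR
  obtain ⟨s, hs, hsq, hs0⟩ := h.exists_sqrt hR hw
  have hsd : DifferentiableOn ℂ s (ball a R) :=
    fun x hx ↦ (hs x hx).differentiableAt.differentiableWithinAt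
  have hinj : InjOn (fun x ↦ s x ^ 2) (ball a R) := fun x hx y hy hxy ↦ by
    simp only [hsq x hx, hsq y hy, sub_left_inj] at hxy
    exact h.injOn hx hy hxy
  have hda : ‖s a‖ ≤ 4 * (‖deriv s a‖ * R) := by
    have hpos : 0 < ‖φ a - w‖ := norm_pos_iff.2 (sub_ne_zero.2 (hw a ha))
    have hratio : 1 ≤ 4 * (‖deriv φ a‖ / ‖φ a - w‖ / 2 * R) := by
      rw [div_div, div_mul_eq_mul_div, mul_div, le_div_iff₀ (by positivity)]
      linarith
    rw [(hs a ha).deriv, norm_mul, norm_div, norm_div, Complex.norm_ofNat]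
    linarith [mul_le_mul_of_nonneg_left hratio (norm_nonneg (s a))]
  have hsz : ‖s z‖ ≤ 5 * ‖s a‖ := norm_le_of_norm_add_ge hR hsd (hs0 a)
    (fun x hx ↦ by linarith [norm_add_ge_of_injOn_sq hR hsd (fun x _ ↦ hs0 x) hinj hx]) hz
  have hφz : ‖φ z - w‖ ≤ 25 * ‖φ a - w‖ := by
    rw [← hsq z hzR, ← hsq a ha, norm_pow, norm_pow]
    linarith [pow_le_pow_left₀ (norm_nonneg _) hsz 2]
  have htri := _root_.norm_sub_le (φ z - w) (φ a - w)
  rw [sub_sub_sub_cancel_right] at htri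
  linarith

-- Two Cauchy estimates on discs of radius `r`.
lemma norm_deriv_deriv_le (h : IsInverseBranch F φ a R) (hF : Differentiable ℂ F) (hR : 0 < R) :
    ‖deriv (deriv φ) a‖ ≤ 4 * 10 ^ 10 / R * ‖deriv φ a‖ := by
  set r : ℝ := R / 25600 with hr
  have hr0 : 0 < r := by positivity
  have hsub : closedBall a r ⊆ ball a R := closedBall_subset_ball (by rw [hr]; linarith)
  have hderiv : ∀ z ∈ closedBall a r, ‖deriv φ z‖ ≤ 52 * R * ‖deriv φ a‖ / r := by
    intro z hz
    have hzz : closedBall z r ⊆ closedBall a (R / 12800) :=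
      closedBall_subset_closedBall' (by rw [mem_closedBall] at hz; rw [hr] at *; linarith)
    have hzR : closedBall z r ⊆ ball a R := hzz.trans (closedBall_subset_ball (by linarith))
    have := Complex.norm_deriv_le_of_forall_mem_sphere_norm_le hr0
      (((h.diff.sub_const (φ a)).mono hzR).diffContOnCl_ball subset_rfl)
      (fun x hx ↦ h.norm_sub_le hF hR (hzz (sphere_subset_closedBall hx)))
    rwa [deriv_sub_const] at this
  calc ‖deriv (deriv φ) a‖ ≤ 52 * R * ‖deriv φ a‖ / r / r :=
        Complex.norm_deriv_le_of_forall_mem_sphere_norm_le hr0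
          (((h.diff.deriv isOpen_ball).mono hsub).diffContOnCl_ball subset_rfl)
          (fun x hx ↦ hderiv x (sphere_subset_closedBall hx))
    _ = 52 * 25600 ^ 2 / R * ‖deriv φ a‖ := by rw [hr]; field_simp
    _ ≤ 4 * 10 ^ 10 / R * ‖deriv φ a‖ :=
        mul_le_mul_of_nonneg_right (div_le_div_of_nonneg_right (by norm_num) hR.le) (norm_nonneg _)

end IsInverseBranch

/-- The constant in the distortion theorem `IsInverseBranch.norm_deriv_le`. -/
noncomputable def distortionConst : ℝ := Real.exp (8 * 10 ^ 10)

lemma distortionConst_pos : 0 < distortionConst := Real.exp_pos _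

-- Koebe's distortion theorem: `log (deriv φ)` has a bounded derivative on `ball a (R / 2)`.
lemma IsInverseBranch.norm_deriv_le {F φ : ℂ → ℂ} {a : ℂ} {R : ℝ} (h : IsInverseBranch F φ a R)
    (hF : Differentiable ℂ F) {x y : ℂ} (hx : x ∈ ball a (R / 2)) (hy : y ∈ ball a (R / 2)) :
    ‖deriv φ x‖ ≤ distortionConst * ‖deriv φ y‖ := by
  have hR2 : 0 < R / 2 := nonempty_ball.1 ⟨x, hx⟩
  have hsub : ball a (R / 2) ⊆ ball a R := ball_subset_ball (by linarith)
  have h0 : ∀ x ∈ ball a (R / 2), deriv φ x ≠ 0 := fun x hx ↦ h.deriv_ne_zero hF (hsub hx)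
  obtain ⟨l, hl, hle⟩ := exists_hasDerivAt_log (isSimplyConnected_ball hR2) isOpen_ball
    ((h.diff.deriv isOpen_ball).mono hsub) h0
  have hbd : ∀ z ∈ ball a (R / 2), ‖deriv (deriv φ) z / deriv φ z‖ ≤ 8 * 10 ^ 10 / R := by
    intro z hz
    rw [norm_div, div_le_iff₀ (norm_pos_iff.2 (h0 z hz))]
    have hz' : IsInverseBranch F φ z (R / 2) := h.mono
      (ball_subset_ball' (by rw [mem_ball] at hz; linarith))
    refine (hz'.norm_deriv_deriv_le hF hR2).trans_eq ?_
    field_simp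
    ring
  have hR : 0 < R := by linarith
  have hxy : ‖x - y‖ ≤ R := by
    rw [← dist_eq_norm]
    linarith [dist_triangle_right x y a, mem_ball.1 hx, mem_ball.1 hy]
  have hl_sub : ‖l x - l y‖ ≤ 8 * 10 ^ 10 :=
    calc ‖l x - l y‖ ≤ 8 * 10 ^ 10 / R * ‖x - y‖ :=
          (convex_ball a (R / 2)).norm_image_sub_le_of_norm_hasDerivWithin_le
            (fun z hz ↦ (hl z hz).hasDerivWithinAt) hbd hy hx
      _ ≤ 8 * 10 ^ 10 / R * R := by gcongr
      _ = 8 * 10 ^ 10 := div_mul_cancel₀ _ hR.ne'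
  have hre : (l x).re ≤ 8 * 10 ^ 10 + (l y).re := by
    have := (Complex.re_le_norm (l x - l y)).trans hl_sub
    rw [Complex.sub_re] at this
    linarith
  rw [← hle x hx, ← hle y hy, Complex.norm_exp, Complex.norm_exp, distortionConst, ← Real.exp_add]
  exact Real.exp_le_exp.2 hre

/-! ### Change of variables for holomorphic maps -/

lemma lintegral_image_of_hasDerivAt {φ φ' : ℂ → ℂ} {s : Set ℂ} (hs : MeasurableSet s)
    (hd : ∀ x ∈ s, HasDerivAt φ (φ' x) x) (hinj : InjOn φ s) (g : ℂ → ENNReal) :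
    ∫⁻ x in φ '' s, g x = ∫⁻ x in s, ENNReal.ofReal (‖φ' x‖ ^ 2) * g (φ x) := by
  have hdet : ∀ c : ℂ,
      ((ContinuousLinearMap.toSpanSingleton ℂ c).restrictScalars ℝ).det = ‖c‖ ^ 2 := by
    intro c
    rw [← Complex.normSq_eq_norm_sq, ← Algebra.norm_complex_apply, Algebra.norm_apply]
    simp only [ContinuousLinearMap.det]
    congr 1
    ext
    simp [mul_comm]
  rw [lintegral_image_eq_lintegral_abs_det_fderiv_mul volume hs
    (fun x hx ↦ ((hd x hx).hasFDerivAt.restrictScalars ℝ).hasFDerivWithinAt) hinj g]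
  simp only [hdet, abs_sq]

/-! ### The exponential family -/

variable {lam : ℂ}

lemma hasDerivAt_expMap (lam z : ℂ) : HasDerivAt (expMap lam) (expMap lam z) z :=
  (Complex.hasDerivAt_exp z).const_mul lam

lemma differentiable_expMap (lam : ℂ) : Differentiable ℂ (expMap lam) :=
  fun z ↦ (hasDerivAt_expMap lam z).differentiableAt

lemma differentiable_iterate (lam : ℂ) (n : ℕ) : Differentiable ℂ (expMap lam)^[n] :=
  (differentiable_expMap lam).iterate n

lemma measurable_expMap (lam : ℂ) : Measurable (expMap lam) :=
  (differentiable_expMap lam).continuous.measurable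

lemma measurable_iterate (lam : ℂ) (n : ℕ) : Measurable (expMap lam)^[n] :=
  (differentiable_iterate lam n).continuous.measurable

lemma expMap_ne_zero (hlam : lam ≠ 0) (z : ℂ) : expMap lam z ≠ 0 :=
  mul_ne_zero hlam (Complex.exp_ne_zero z)

lemma norm_expMap (lam z : ℂ) : ‖expMap lam z‖ = ‖lam‖ * Real.exp z.re := by
  rw [expMap, norm_mul, Complex.norm_exp]

lemma expMap_eq_iff (hlam : lam ≠ 0) {z w : ℂ} :
    expMap lam z = expMap lam w ↔ ∃ k : ℤ, z = w + k * (2 * Real.pi * Complex.I) := by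
  rw [expMap, expMap, mul_right_inj' hlam, Complex.exp_eq_exp_iff_exists_int]

lemma expMap_add_int_mul (lam z : ℂ) (k : ℤ) :
    expMap lam (z + k * (2 * Real.pi * Complex.I)) = expMap lam z := by
  rw [expMap, expMap, Complex.exp_eq_exp_iff_exists_int.2 ⟨k, rfl⟩]

lemma deriv_iterate_succ (lam : ℂ) (n : ℕ) (z : ℂ) :
    deriv (expMap lam)^[n + 1] z = expMap lam ((expMap lam)^[n] z) * deriv (expMap lam)^[n] z := by
  rw [Function.iterate_succ']
  exact ((hasDerivAt_expMap lam _).comp z (differentiable_iterate lam n z).hasDerivAt).deriv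

/-- The finite part of the post-singular set. -/
def postOrbit (lam : ℂ) : Set ℂ := closure (forwardOrbit (expMap lam) 0)

lemma isClosed_postOrbit (lam : ℂ) : IsClosed (postOrbit lam) := isClosed_closure

lemma iterate_zero_mem_postOrbit (lam : ℂ) (n : ℕ) : (expMap lam)^[n] 0 ∈ postOrbit lam :=
  subset_closure ⟨n, rfl⟩

lemma mapsTo_expMap_postOrbit (lam : ℂ) : MapsTo (expMap lam) (postOrbit lam) (postOrbit lam) := by
  refine MapsTo.closure ?_ (differentiable_expMap lam).continuous
  rintro _ ⟨n, rfl⟩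
  exact ⟨n + 1, Function.iterate_succ_apply' _ _ _⟩

lemma exists_ball_disjoint_postOrbit {x : ℂ} (hx : x ∉ postOrbit lam) :
    ∃ r > 0, Disjoint (ball x (2 * r)) (postOrbit lam) := by
  obtain ⟨ε, hε, hsub⟩ := isOpen_iff.1 (isClosed_postOrbit lam).isOpen_compl x hx
  refine ⟨ε / 2, by positivity, ?_⟩
  rw [mul_div_cancel₀ _ two_ne_zero]
  exact Set.disjoint_left.2 hsub

/-! ### The transfer operator -/

/-- The branches of the inverse of `expMap lam`. -/
noncomputable def logBranch (lam : ℂ) (k : ℤ) (x : ℂ) : ℂ :=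
  Complex.log (x / lam) + k * (2 * Real.pi * Complex.I)

/-- The range of the branch `logBranch lam k`, a horizontal strip of height `2π`. -/
def logStrip (lam : ℂ) (k : ℤ) : Set ℂ := {z | logBranch lam k (expMap lam z) = z}

/-- The transfer operator of `expMap lam` with respect to Lebesgue measure. All branches of the
inverse have the derivative `x⁻¹`, whence the weight. -/
noncomputable def transfer (lam : ℂ) (g : ℂ → ENNReal) (x : ℂ) : ENNReal :=
  ∑' k : ℤ, g (logBranch lam k x) * ENNReal.ofReal ((‖x‖ ^ 2)⁻¹)

lemma measurable_logBranch (lam : ℂ) (k : ℤ) : Measurable (logBranch lam k) :=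
  (Complex.measurable_log.comp (measurable_id.div_const lam)).add_const _

lemma expMap_logBranch (hlam : lam ≠ 0) (k : ℤ) {x : ℂ} (hx : x ≠ 0) :
    expMap lam (logBranch lam k x) = x := by
  rw [logBranch, expMap_add_int_mul, expMap, Complex.exp_log (div_ne_zero hx hlam),
    mul_div_cancel₀ _ hlam]

lemma exists_logBranch_expMap (hlam : lam ≠ 0) (z : ℂ) :
    ∃ m : ℤ, ∀ k, logBranch lam k (expMap lam z) =
      z + ((k + m : ℤ) : ℂ) * (2 * Real.pi * Complex.I) := by
  obtain ⟨m, hm⟩ := (expMap_eq_iff hlam).1 (expMap_logBranch hlam 0 (expMap_ne_zero hlam z))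
  refine ⟨m, fun k ↦ ?_⟩
  simp only [logBranch, Int.cast_zero, zero_mul, add_zero] at hm ⊢
  rw [hm]
  push_cast
  ring

lemma logBranch_injective (lam x : ℂ) : Function.Injective fun k ↦ logBranch lam k x := by
  intro k l h
  simpa [logBranch, Real.pi_ne_zero] using h

lemma measurableSet_logStrip (lam : ℂ) (k : ℤ) : MeasurableSet (logStrip lam k) :=
  measurableSet_eq_fun ((measurable_logBranch lam k).comp (measurable_expMap lam)) measurable_id

lemma iUnion_logStrip (hlam : lam ≠ 0) : ⋃ k, logStrip lam k = univ := by
  refine iUnion_eq_univ_iff.2 fun z ↦ ?_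
  obtain ⟨m, hm⟩ := exists_logBranch_expMap hlam z
  refine ⟨-m, ?_⟩
  rw [logStrip, mem_ofPred_eq, hm]
  simp

lemma pairwise_disjoint_logStrip (lam : ℂ) :
    Pairwise (Function.onFun Disjoint (logStrip lam)) := fun _ _ hkl ↦
  Set.disjoint_left.2 fun z hz hz' ↦
    hkl (logBranch_injective lam (expMap lam z) (hz.trans hz'.symm))

lemma injOn_expMap_logStrip (lam : ℂ) (k : ℤ) : InjOn (expMap lam) (logStrip lam k) :=
  LeftInvOn.injOn (f₁' := logBranch lam k) fun _ hz ↦ hz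

lemma image_expMap_logStrip_inter_preimage (hlam : lam ≠ 0) (k : ℤ) (A : Set ℂ) :
    expMap lam '' (logStrip lam k ∩ expMap lam ⁻¹' A) = A \ {0} := by
  rw [image_inter_preimage, inter_comm, sdiff_eq]
  congr 1
  refine Subset.antisymm (image_subset_iff.2 fun z _ ↦ expMap_ne_zero hlam z) fun x hx ↦ ?_
  have hx' := expMap_logBranch hlam k hx
  exact ⟨logBranch lam k x, by rw [logStrip, mem_ofPred_eq, hx'], hx'⟩

lemma setLIntegral_logStrip_inter_preimage (hlam : lam ≠ 0) (k : ℤ) {A : Set ℂ}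
    (hA : MeasurableSet A) (g : ℂ → ENNReal) :
    ∫⁻ z in logStrip lam k ∩ expMap lam ⁻¹' A, g z =
      ∫⁻ x in A, g (logBranch lam k x) * ENNReal.ofReal ((‖x‖ ^ 2)⁻¹) := by
  have hS : MeasurableSet (logStrip lam k ∩ expMap lam ⁻¹' A) :=
    (measurableSet_logStrip lam k).inter (measurable_expMap lam hA)
  have hae : (A \ {0} : Set ℂ) =ᵐ[volume] A := sdiff_null_ae_eq_self (measure_singleton 0)
  rw [← setLIntegral_congr hae, ← image_expMap_logStrip_inter_preimage hlam k A,
    lintegral_image_of_hasDerivAt hS (fun x _ ↦ hasDerivAt_expMap lam x)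
      ((injOn_expMap_logStrip lam k).mono inter_subset_left)]
  refine setLIntegral_congr_fun hS fun z hz ↦ ?_
  have hz' : logBranch lam k (expMap lam z) = z := hz.1
  have hpos : 0 < ‖expMap lam z‖ ^ 2 := pow_pos (norm_pos_iff.2 (expMap_ne_zero hlam z)) 2
  simp only [hz']
  rw [mul_comm, mul_assoc, ← ENNReal.ofReal_mul (by positivity), inv_mul_cancel₀ hpos.ne',
    ENNReal.ofReal_one, mul_one]

lemma setLIntegral_preimage (hlam : lam ≠ 0) {A : Set ℂ} (hA : MeasurableSet A)
    {g : ℂ → ENNReal} (hg : Measurable g) :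
    ∫⁻ z in expMap lam ⁻¹' A, g z = ∫⁻ x in A, transfer lam g x := by
  have hterm : ∀ k, Measurable
      fun x ↦ g (logBranch lam k x) * ENNReal.ofReal ((‖x‖ ^ 2)⁻¹) :=
    fun k ↦ (hg.comp (measurable_logBranch lam k)).mul (by fun_prop)
  calc ∫⁻ z in expMap lam ⁻¹' A, g z
      = ∫⁻ z in ⋃ k, logStrip lam k ∩ expMap lam ⁻¹' A, g z := by
        rw [← iUnion_inter, iUnion_logStrip hlam, univ_inter]
    _ = ∑' k, ∫⁻ z in logStrip lam k ∩ expMap lam ⁻¹' A, g z :=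
        lintegral_iUnion
          (fun k ↦ (measurableSet_logStrip lam k).inter (measurable_expMap lam hA))
          (fun k l hkl ↦ (pairwise_disjoint_logStrip lam hkl).mono inter_subset_left
            inter_subset_left) _
    _ = ∑' k, ∫⁻ x in A, g (logBranch lam k x) * ENNReal.ofReal ((‖x‖ ^ 2)⁻¹) :=
        tsum_congr fun k ↦ setLIntegral_logStrip_inter_preimage hlam k hA g
    _ = ∫⁻ x in A, transfer lam g x := (lintegral_tsum fun k ↦ (hterm k).aemeasurable).symm

lemma transfer_expMap (hlam : lam ≠ 0) (g : ℂ → ENNReal) (w : ℂ) :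
    transfer lam g (expMap lam w) = ∑' k : ℤ, g (w + k * (2 * Real.pi * Complex.I)) *
      ENNReal.ofReal ((‖expMap lam w‖ ^ 2)⁻¹) := by
  obtain ⟨m, hm⟩ := exists_logBranch_expMap hlam w
  simp only [transfer, hm]
  exact Equiv.tsum_eq (Equiv.addRight m) fun k : ℤ ↦
    g (w + k * (2 * Real.pi * Complex.I)) * ENNReal.ofReal ((‖expMap lam w‖ ^ 2)⁻¹)

lemma measurable_transfer {g : ℂ → ENNReal} (hg : Measurable g) :
    Measurable (transfer lam g) :=
  Measurable.tsum fun k ↦ (hg.comp (measurable_logBranch lam k)).mul (by fun_prop)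

lemma measurable_transfer_iterate {g : ℂ → ENNReal} (hg : Measurable g) (n : ℕ) :
    Measurable ((transfer lam)^[n] g) := by
  induction n with
  | zero => exact hg
  | succ n ih => rw [Function.iterate_succ_apply']; exact measurable_transfer ih

lemma transfer_add (g h : ℂ → ENNReal) :
    transfer lam (g + h) = transfer lam g + transfer lam h := by
  ext x
  simp only [transfer, Pi.add_apply, add_mul, ENNReal.tsum_add]

lemma transfer_zero : transfer lam 0 = 0 := by
  ext x
  simp [transfer]

lemma transfer_sum {ι : Type*} (s : Finset ι) (g : ι → ℂ → ENNReal) :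
    transfer lam (∑ i ∈ s, g i) = ∑ i ∈ s, transfer lam (g i) :=
  map_sum (⟨⟨transfer lam, transfer_zero⟩, transfer_add⟩ : (ℂ → ENNReal) →+ (ℂ → ENNReal)) g s

lemma transfer_mono {g h : ℂ → ENNReal} (hgh : g ≤ h) : transfer lam g ≤ transfer lam h :=
  fun _ ↦ ENNReal.tsum_le_tsum fun _ ↦ mul_le_mul_left (hgh _) _

lemma transfer_mul_const (g : ℂ → ENNReal) (c : ENNReal) (x : ℂ) :
    transfer lam (fun z ↦ g z * c) x = transfer lam g x * c := by
  simp only [transfer, ← ENNReal.tsum_mul_right]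
  exact tsum_congr fun k ↦ by ring

lemma transfer_indicator (hlam : lam ≠ 0) {E : Set ℂ} (hE : expMap lam ⁻¹' E = E)
    (g : ℂ → ENNReal) : transfer lam (E.indicator g) = E.indicator (transfer lam g) := by
  ext x
  rcases eq_or_ne x 0 with rfl | hx
  · simp [transfer, indicator]
  have hmem : ∀ k, logBranch lam k x ∈ E ↔ x ∈ E := fun k ↦ by
    rw [← hE, mem_preimage, expMap_logBranch hlam k hx, hE]
  by_cases hxE : x ∈ E <;> simp [transfer, hmem, hxE]

lemma setLIntegral_preimage_iterate (hlam : lam ≠ 0) {A : Set ℂ} (hA : MeasurableSet A)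
    {g : ℂ → ENNReal} (hg : Measurable g) (n : ℕ) :
    ∫⁻ z in (expMap lam)^[n] ⁻¹' A, g z = ∫⁻ x in A, (transfer lam)^[n] g x := by
  induction n generalizing g with
  | zero => rfl
  | succ n ih =>
    rw [Function.iterate_succ_apply, ← ih (measurable_transfer hg),
      ← setLIntegral_preimage hlam (measurable_iterate lam n hA) hg, ← preimage_comp,
      ← Function.iterate_succ]

lemma lintegral_transfer_iterate (hlam : lam ≠ 0) {g : ℂ → ENNReal} (hg : Measurable g) (n : ℕ) :
    ∫⁻ x, (transfer lam)^[n] g x = ∫⁻ z, g z := by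
  simpa using (setLIntegral_preimage_iterate hlam MeasurableSet.univ hg n).symm

lemma volume_preimage_iterate_eq_zero (hlam : lam ≠ 0) {A : Set ℂ} (hA : MeasurableSet A)
    (h0 : volume A = 0) (n : ℕ) : volume ((expMap lam)^[n] ⁻¹' A) = 0 := by
  rw [← setLIntegral_one, setLIntegral_preimage_iterate hlam hA measurable_const n,
    setLIntegral_measure_zero _ _ h0]

/-! ### Inverse branches of iterates -/

lemma IsInverseBranch.exists_lift {F φ : ℂ → ℂ} {a : ℂ} {R : ℝ} (hφ : IsInverseBranch F φ a R)
    (hlam : lam ≠ 0) (hR : 0 < R) (hne : ∀ x ∈ ball a R, φ x ≠ 0) :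
    ∃ ψ : ℤ → ℂ → ℂ, (∀ k, IsInverseBranch (F ∘ expMap lam) (ψ k) a R) ∧
      (∀ k, ∀ x ∈ ball a R, deriv (ψ k) x = deriv φ x / φ x) ∧
      (∀ x ∈ ball a R, ∀ w, expMap lam w = φ x → ∃ k, ψ k x = w) ∧
      ∀ x ∈ ball a R, ∀ g : ℂ → ENNReal, transfer lam g (φ x) =
        ∑' k, g (ψ k x) * ENNReal.ofReal ((‖φ x‖ ^ 2)⁻¹) := by
  obtain ⟨l, hl, hle⟩ := exists_hasDerivAt_log (isSimplyConnected_ball hR) isOpen_ball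
    (hφ.diff.div_const lam) (fun x hx ↦ div_ne_zero (hne x hx) hlam)
  have hlE : ∀ x ∈ ball a R, expMap lam (l x) = φ x := fun x hx ↦ by
    rw [expMap, hle x hx, mul_div_cancel₀ _ hlam]
  have hψ : ∀ k : ℤ, ∀ x ∈ ball a R, HasDerivAt
      (fun x ↦ l x + k * (2 * Real.pi * Complex.I)) (deriv φ x / φ x) x := fun k x hx ↦ by
    have := (hl x hx).add_const (k * (2 * Real.pi * Complex.I) : ℂ)
    rwa [deriv_div_const, div_div_div_cancel_right₀ hlam] at this
  refine ⟨fun k x ↦ l x + k * (2 * Real.pi * Complex.I), fun k ↦ ⟨fun x hx ↦ ?_, fun x hx ↦ ?_⟩,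
    fun k x hx ↦ (hψ k x hx).deriv, fun x hx w hw ↦ ?_, fun x hx g ↦ ?_⟩
  · exact (hψ k x hx).differentiableAt.differentiableWithinAt
  · rw [Function.comp_apply, expMap_add_int_mul, hlE x hx, hφ.right_inv x hx]
  · rw [← hlE x hx, expMap_eq_iff hlam] at hw
    exact hw.imp fun k hk ↦ hk.symm
  · rw [← hlE x hx, transfer_expMap hlam]

lemma exists_inverseBranches (hlam : lam ≠ 0) {a : ℂ} {R : ℝ} (hR : 0 < R)
    (hd : Disjoint (ball a R) (postOrbit lam)) (n : ℕ) :
    ∃ (ι : Type) (φ : ι → ℂ → ℂ), (∀ i, IsInverseBranch (expMap lam)^[n] (φ i) a R) ∧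
      (∀ x ∈ ball a R, ∀ w, (expMap lam)^[n] w = x → ∃ i, φ i x = w) ∧
      ∀ x ∈ ball a R, ∀ g : ℂ → ENNReal, (transfer lam)^[n] g x =
        ∑' i, g (φ i x) * ENNReal.ofReal (‖deriv (φ i) x‖ ^ 2) := by
  induction n with
  | zero =>
    exact ⟨Unit, fun _ ↦ id, fun _ ↦ ⟨differentiableOn_id, fun x _ ↦ rfl⟩,
      fun x _ w hw ↦ ⟨(), hw.symm⟩, fun x _ g ↦ by simp⟩
  | succ n ih =>
    obtain ⟨ι, φ, hφ, hsurj, htransfer⟩ := ih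
    have hne : ∀ i, ∀ x ∈ ball a R, φ i x ≠ 0 := fun i x hx h0 ↦ by
      have hx' := (hφ i).right_inv x hx
      rw [h0] at hx'
      exact Set.disjoint_left.1 hd hx (hx' ▸ iterate_zero_mem_postOrbit lam n)
    choose ψ hψ hψ' hψ_surj hψ_transfer using fun i ↦ (hφ i).exists_lift hlam hR (hne i)
    refine ⟨ι × ℤ, fun p ↦ ψ p.1 p.2, fun p ↦ hψ p.1 p.2, fun x hx w hw ↦ ?_, fun x hx g ↦ ?_⟩
    · rw [Function.iterate_succ_apply] at hw
      obtain ⟨i, hi⟩ := hsurj x hx _ hw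
      obtain ⟨k, hk⟩ := hψ_surj i x hx w hi.symm
      exact ⟨(i, k), hk⟩
    · rw [Function.iterate_succ_apply, htransfer x hx,
        ENNReal.tsum_prod (f := fun i k ↦ g (ψ i k x) * ENNReal.ofReal (‖deriv (ψ i k) x‖ ^ 2))]
      refine tsum_congr fun i ↦ ?_
      rw [hψ_transfer i x hx, ← ENNReal.tsum_mul_right]
      refine tsum_congr fun k ↦ ?_
      rw [hψ' i k x hx, mul_assoc, ← ENNReal.ofReal_mul (by positivity), norm_div, div_pow,
        inv_mul_eq_div]

lemma exists_inverseBranch (hlam : lam ≠ 0) {a : ℂ} {R : ℝ}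
    (hd : Disjoint (ball a R) (postOrbit lam)) (n : ℕ) {x w : ℂ} (hx : x ∈ ball a R)
    (hw : (expMap lam)^[n] w = x) :
    ∃ φ, IsInverseBranch (expMap lam)^[n] φ a R ∧ φ x = w := by
  obtain ⟨ι, φ, hφ, hsurj, -⟩ :=
    exists_inverseBranches hlam (pos_of_mem_ball hx) hd n
  obtain ⟨i, hi⟩ := hsurj x hx w hw
  exact ⟨φ i, hφ i, hi⟩

namespace IsInverseBranch

variable {φ : ℂ → ℂ} {a : ℂ} {R : ℝ}

-- The translates of the image by `2πi` are images of other branches, hence disjoint from it.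
lemma norm_deriv_mul_le {n : ℕ} (h : IsInverseBranch (expMap lam)^[n + 1] φ a R) (hR : 0 < R) :
    ‖deriv φ a‖ * R ≤ 640 := by
  refine norm_deriv_mul_le_of_ne_add_two_pi_I hR h.diff fun x hx y hy hxy ↦ ?_
  have hiter : (expMap lam)^[n + 1] (φ x) = (expMap lam)^[n + 1] (φ y) := by
    have := expMap_add_int_mul lam (φ y) 1
    rw [Int.cast_one, one_mul] at this
    rw [Function.iterate_succ_apply, Function.iterate_succ_apply, hxy, this]
  rw [h.right_inv x hx, h.right_inv y hy] at hiter
  subst hiter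
  exact Complex.two_pi_I_ne_zero (left_eq_add.1 hxy)

lemma norm_sub_le_mul {F : ℂ → ℂ} (h : IsInverseBranch F φ a R)
    (hF : Differentiable ℂ F) {x y z : ℂ} (hx : x ∈ ball a (R / 2)) (hy : y ∈ ball a (R / 2))
    (hz : z ∈ ball a (R / 2)) :
    ‖φ x - φ y‖ ≤ distortionConst * ‖deriv φ z‖ * ‖x - y‖ := by
  have hsub : ball a (R / 2) ⊆ ball a R := ball_subset_ball (by linarith [pos_of_mem_ball hx])
  exact (convex_ball a (R / 2)).norm_image_sub_le_of_norm_hasDerivWithin_le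
    (fun w hw ↦ (h.hasDerivAt (hsub hw)).hasDerivWithinAt)
    (fun w hw ↦ h.norm_deriv_le hF hw hz) hy hx

end IsInverseBranch

/-! ### Iterated densities -/

/-- An integrable density with bounded oscillation at bounded scales. -/
noncomputable def baseDensity (z : ℂ) : ENNReal := ENNReal.ofReal ((1 + ‖z‖) ^ (-3 : ℝ))

lemma measurable_baseDensity : Measurable baseDensity := by
  unfold baseDensity
  fun_prop

lemma lintegral_baseDensity_lt_top : ∫⁻ z, baseDensity z < ⊤ :=
  finite_integral_one_add_norm (by rw [Complex.finrank_real_complex]; norm_num)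

lemma baseDensity_pos (z : ℂ) : 0 < baseDensity z :=
  ENNReal.ofReal_pos.2 (by positivity)

lemma baseDensity_le {x y : ℂ} {C : ℝ} (h : ‖x - y‖ ≤ C) :
    baseDensity x ≤ ENNReal.ofReal ((1 + C) ^ 3) * baseDensity y := by
  have hC : 0 ≤ C := (norm_nonneg _).trans h
  have hnorm : 1 + ‖y‖ ≤ (1 + C) * (1 + ‖x‖) := by
    have := norm_sub_norm_le y x
    rw [norm_sub_rev] at this
    nlinarith [norm_nonneg x]
  have hrpow : ∀ t : ℝ, 0 ≤ t → (1 + t) ^ (-3 : ℝ) = ((1 + t) ^ 3)⁻¹ := fun t ht ↦ by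
    rw [Real.rpow_neg (by positivity)]
    norm_cast
  rw [baseDensity, baseDensity, ← ENNReal.ofReal_mul (by positivity)]
  refine ENNReal.ofReal_le_ofReal ?_
  rw [hrpow _ (norm_nonneg x), hrpow _ (norm_nonneg y), ← div_eq_mul_inv, inv_eq_one_div,
    div_le_div_iff₀ (by positivity) (by positivity), one_mul, ← mul_pow]
  exact pow_le_pow_left₀ (by positivity) hnorm 3

/-- The oscillation constant of iterated densities on discs of radius `r`: the images of such a disc
under inverse branches have diameter at most `1280 + 2 * r`. -/
noncomputable def oscConst (r : ℝ) : ENNReal :=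
  ENNReal.ofReal ((1 + (1280 + 2 * r)) ^ 3) * ENNReal.ofReal (distortionConst ^ 2)

lemma oscConst_ne_top (r : ℝ) : oscConst r ≠ ⊤ :=
  ENNReal.mul_ne_top ENNReal.ofReal_ne_top ENNReal.ofReal_ne_top

lemma IsInverseBranch.norm_sub_le_add {φ : ℂ → ℂ} {a : ℂ} {r : ℝ} {n : ℕ}
    (h : IsInverseBranch (expMap lam)^[n] φ a (2 * r)) {x y : ℂ} (hx : x ∈ ball a r)
    (hy : y ∈ ball a r) : ‖φ x - φ y‖ ≤ 1280 + 2 * r := by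
  have hr : 0 < r := pos_of_mem_ball hx
  have hsub : ball a r ⊆ ball a (2 * r) := ball_subset_ball (by linarith)
  have hxy : ‖x - y‖ ≤ 2 * r := by
    rw [← dist_eq_norm]
    linarith [dist_triangle_right x y a, mem_ball.1 hx, mem_ball.1 hy]
  cases n with
  | zero =>
    have hid : ∀ z ∈ ball a r, φ z = z := fun z hz ↦ h.right_inv z (hsub hz)
    rw [hid x hx, hid y hy]
    linarith
  | succ n =>
    have hderiv : ∀ z ∈ ball a r, ‖deriv φ z‖ ≤ 640 / r := fun z hz ↦ by
      rw [le_div_iff₀ hr]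
      exact (h.mono (ball_subset_ball' (by linarith [mem_ball.1 hz]))).norm_deriv_mul_le hr
    calc ‖φ x - φ y‖ ≤ 640 / r * ‖x - y‖ :=
          (convex_ball a r).norm_image_sub_le_of_norm_hasDerivWithin_le
            (fun w hw ↦ (h.hasDerivAt (hsub hw)).hasDerivWithinAt) hderiv hy hx
      _ ≤ 640 / r * (2 * r) := by gcongr
      _ = 1280 := by field_simp; norm_num
      _ ≤ 1280 + 2 * r := by linarith

lemma transfer_iterate_baseDensity_le (hlam : lam ≠ 0) {a : ℂ} {r : ℝ}
    (hd : Disjoint (ball a (2 * r)) (postOrbit lam)) (n : ℕ) {x y : ℂ}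
    (hx : x ∈ ball a r) (hy : y ∈ ball a r) :
    (transfer lam)^[n] baseDensity x ≤ oscConst r * (transfer lam)^[n] baseDensity y := by
  have hr : 0 < r := pos_of_mem_ball hx
  have hsub : ball a r ⊆ ball a (2 * r) := ball_subset_ball (by linarith)
  have hhalf : 2 * r / 2 = r := mul_div_cancel_left₀ r two_ne_zero
  obtain ⟨ι, φ, hφ, -, htransfer⟩ := exists_inverseBranches hlam (by positivity) hd n
  rw [htransfer x (hsub hx), htransfer y (hsub hy), ← ENNReal.tsum_mul_left]
  refine ENNReal.tsum_le_tsum fun i ↦ ?_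
  have hweight : ENNReal.ofReal (‖deriv (φ i) x‖ ^ 2) ≤
      ENNReal.ofReal (distortionConst ^ 2) * ENNReal.ofReal (‖deriv (φ i) y‖ ^ 2) := by
    rw [← ENNReal.ofReal_mul (by positivity), ← mul_pow]
    refine ENNReal.ofReal_le_ofReal (pow_le_pow_left₀ (norm_nonneg _) ?_ 2)
    exact (hφ i).norm_deriv_le (differentiable_iterate lam n) (by rwa [hhalf]) (by rwa [hhalf])
  calc baseDensity (φ i x) * ENNReal.ofReal (‖deriv (φ i) x‖ ^ 2)
      ≤ (ENNReal.ofReal ((1 + (1280 + 2 * r)) ^ 3) * baseDensity (φ i y)) *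
        (ENNReal.ofReal (distortionConst ^ 2) * ENNReal.ofReal (‖deriv (φ i) y‖ ^ 2)) :=
        mul_le_mul' (baseDensity_le ((hφ i).norm_sub_le_add hx hy)) hweight
    _ = oscConst r * (baseDensity (φ i y) * ENNReal.ofReal (‖deriv (φ i) y‖ ^ 2)) := by
        rw [oscConst]; ring

/-- The sum of the first `n` iterates of the base density under the transfer operator. -/
noncomputable def densitySum (lam : ℂ) (n : ℕ) : ℂ → ENNReal :=
  ∑ k ∈ Finset.range n, (transfer lam)^[k] baseDensity

lemma densitySum_apply (n : ℕ) (x : ℂ) :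
    densitySum lam n x = ∑ k ∈ Finset.range n, (transfer lam)^[k] baseDensity x := by
  rw [densitySum, Finset.sum_apply]

lemma measurable_densitySum (n : ℕ) : Measurable (densitySum lam n) := by
  rw [funext (densitySum_apply n)]
  exact Finset.measurable_sum _ fun k _ ↦ measurable_transfer_iterate measurable_baseDensity k

lemma densitySum_le (hlam : lam ≠ 0) {a : ℂ} {r : ℝ}
    (hd : Disjoint (ball a (2 * r)) (postOrbit lam)) (n : ℕ) {x y : ℂ}
    (hx : x ∈ ball a r) (hy : y ∈ ball a r) :
    densitySum lam n x ≤ oscConst r * densitySum lam n y := by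
  rw [densitySum_apply, densitySum_apply, Finset.mul_sum]
  exact Finset.sum_le_sum fun k _ ↦ transfer_iterate_baseDensity_le hlam hd k hx hy

lemma exists_transfer_iterate_le (hlam : lam ≠ 0) {x : ℂ} (hx : x ∉ postOrbit lam) :
    ∃ C : ENNReal, C ≠ ⊤ ∧ ∀ n, (transfer lam)^[n] baseDensity x ≤ C := by
  obtain ⟨r, hr, hd⟩ := exists_ball_disjoint_postOrbit hx
  have hv0 : volume (ball x r) ≠ 0 := (measure_ball_pos _ _ hr).ne'
  have hvt : volume (ball x r) ≠ ⊤ := measure_ball_lt_top.ne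
  refine ⟨oscConst r * (∫⁻ z, baseDensity z) / volume (ball x r),
    ENNReal.div_ne_top (ENNReal.mul_ne_top (oscConst_ne_top r) lintegral_baseDensity_lt_top.ne)
      hv0, fun n ↦ ?_⟩
  rw [ENNReal.le_div_iff_mul_le (Or.inl hv0) (Or.inl hvt), ← setLIntegral_const]
  calc ∫⁻ _ in ball x r, (transfer lam)^[n] baseDensity x
      ≤ ∫⁻ y in ball x r, oscConst r * (transfer lam)^[n] baseDensity y :=
        setLIntegral_mono' measurableSet_ball fun y hy ↦
          transfer_iterate_baseDensity_le hlam hd n (mem_ball_self hr) hy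
    _ = oscConst r * ∫⁻ y in ball x r, (transfer lam)^[n] baseDensity y :=
        lintegral_const_mul _ (measurable_transfer_iterate measurable_baseDensity n)
    _ ≤ oscConst r * ∫⁻ y, (transfer lam)^[n] baseDensity y := by
        gcongr
        exact Measure.restrict_le_self
    _ = oscConst r * ∫⁻ z, baseDensity z := by
        rw [lintegral_transfer_iterate hlam measurable_baseDensity]

lemma densitySum_ne_top (hlam : lam ≠ 0) {x : ℂ} (hx : x ∉ postOrbit lam) (n : ℕ) :
    densitySum lam n x ≠ ⊤ := by
  obtain ⟨C, hC, hle⟩ := exists_transfer_iterate_le hlam hx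
  rw [densitySum_apply]
  exact ENNReal.sum_ne_top.2 fun k _ ↦ ne_top_of_le_ne_top hC (hle k)

lemma densitySum_succ_ne_zero (n : ℕ) (x : ℂ) : densitySum lam (n + 1) x ≠ 0 := by
  rw [densitySum_apply, Finset.sum_range_succ']
  exact ((baseDensity_pos x).trans_le le_add_self).ne'

lemma transfer_densitySum_le (n : ℕ) (x : ℂ) :
    transfer lam (densitySum lam n) x ≤
      densitySum lam n x + (transfer lam)^[n] baseDensity x := by
  rw [densitySum, transfer_sum, Finset.sum_apply, Finset.sum_apply, ← Finset.sum_range_succ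
    (fun k ↦ (transfer lam)^[k] baseDensity x), Finset.sum_range_succ']
  simp only [← Function.iterate_succ_apply' (transfer lam)]
  exact le_self_add

/-! ### The limit density -/

-- Fatou's lemma for the counting measure on the set of branches.
lemma transfer_liminf_le (v : ℕ → ℂ → ENNReal) (x : ℂ) :
    transfer lam (fun z ↦ liminf (fun n ↦ v n z) atTop) x ≤
      liminf (fun n ↦ transfer lam (v n) x) atTop := by
  simp only [transfer]
  have hfatou := lintegral_liminf_le (μ := (Measure.count : Measure ℤ)) (u := atTop)
    (f := fun n k ↦ v n (logBranch lam k x) * ENNReal.ofReal ((‖x‖ ^ 2)⁻¹))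
    (fun n ↦ measurable_from_top)
  simp only [lintegral_count] at hfatou
  refine le_trans (ENNReal.tsum_le_tsum fun k ↦ ?_) hfatou
  rw [ENNReal.liminf_mul_const_of_ne_top ENNReal.ofReal_ne_top, mul_comm]

/-- The limit of the sums of iterated densities, normalised at the point `a`. -/
noncomputable def limitDensity (lam a x : ℂ) : ENNReal :=
  liminf (fun n ↦ densitySum lam n x * (densitySum lam n a)⁻¹) atTop

lemma measurable_limitDensity (lam a : ℂ) : Measurable (limitDensity lam a) :=
  Measurable.liminf fun n ↦ (measurable_densitySum n).mul_const _

lemma limitDensity_le (hlam : lam ≠ 0) (a : ℂ) {b : ℂ} {r : ℝ}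
    (hd : Disjoint (ball b (2 * r)) (postOrbit lam)) {x y : ℂ}
    (hx : x ∈ ball b r) (hy : y ∈ ball b r) :
    limitDensity lam a x ≤ oscConst r * limitDensity lam a y := by
  rw [limitDensity, limitDensity, ← ENNReal.liminf_const_mul_of_ne_top (oscConst_ne_top r)]
  refine liminf_le_liminf (Eventually.of_forall fun n ↦ ?_)
  rw [← mul_assoc]
  exact mul_le_mul_left (densitySum_le hlam hd n hx hy) _

lemma limitDensity_self (hlam : lam ≠ 0) {a : ℂ} (ha : a ∉ postOrbit lam) :
    limitDensity lam a a = 1 := by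
  rw [limitDensity, liminf_congr (v := fun _ ↦ (1 : ENNReal)) ?_, liminf_const]
  filter_upwards [eventually_ge_atTop 1] with n hn
  obtain ⟨n, rfl⟩ := Nat.exists_eq_add_of_le' hn
  exact ENNReal.mul_inv_cancel (densitySum_succ_ne_zero n a) (densitySum_ne_top hlam ha _)

-- The error term `transfer^[n] baseDensity x` is bounded, while the normalising factor diverges.
lemma transfer_limitDensity_le (hlam : lam ≠ 0) {a : ℂ}
    (ha : Tendsto (fun n ↦ densitySum lam n a) atTop (𝓝 ⊤)) {x : ℂ} (hx : x ∉ postOrbit lam) :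
    transfer lam (limitDensity lam a) x ≤ limitDensity lam a x := by
  obtain ⟨C, hC, hbd⟩ := exists_transfer_iterate_le hlam hx
  refine (transfer_liminf_le _ x).trans ?_
  have herror : Tendsto (fun n ↦ (transfer lam)^[n] baseDensity x * (densitySum lam n a)⁻¹) atTop
      (𝓝 0) := by
    have hC0 : Tendsto (fun n ↦ C * (densitySum lam n a)⁻¹) atTop (𝓝 (C * (⊤ : ENNReal)⁻¹)) :=
      ENNReal.Tendsto.const_mul (tendsto_inv_iff.2 ha) (Or.inr hC)
    rw [ENNReal.inv_top, mul_zero] at hC0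
    exact tendsto_of_tendsto_of_tendsto_of_le_of_le tendsto_const_nhds hC0
      (fun n ↦ zero_le) (fun n ↦ mul_le_mul_left (hbd n) _)
  refine le_trans ?_ (ENNReal.liminf_add_of_right_tendsto_zero herror _).le
  refine liminf_le_liminf (Eventually.of_forall fun n ↦ ?_)
  simp only [transfer_mul_const, Pi.add_apply]
  rw [← add_mul]
  exact mul_le_mul_left (transfer_densitySum_le n x) _

lemma sum_setLIntegral_baseDensity_le (hlam : lam ≠ 0) {a : ℂ} {r : ℝ} (hr : 0 < r)
    (hd : Disjoint (ball a (2 * r)) (postOrbit lam)) (n : ℕ) :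
    ∑ k ∈ Finset.range n, ∫⁻ z in (expMap lam)^[k] ⁻¹' ball a r, baseDensity z ≤
      densitySum lam n a * (oscConst r * volume (ball a r)) := by
  simp only [setLIntegral_preimage_iterate hlam measurableSet_ball measurable_baseDensity]
  rw [← lintegral_finsetSum _ fun k _ ↦ measurable_transfer_iterate measurable_baseDensity k]
  simp only [← densitySum_apply]
  calc ∫⁻ x in ball a r, densitySum lam n x
      ≤ ∫⁻ _ in ball a r, oscConst r * densitySum lam n a :=
        setLIntegral_mono' measurableSet_ball fun y hy ↦
          densitySum_le hlam hd n hy (mem_ball_self hr)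
    _ = densitySum lam n a * (oscConst r * volume (ball a r)) := by rw [setLIntegral_const]; ring

lemma tendsto_densitySum (hlam : lam ≠ 0) {a : ℂ} {r : ℝ} (hr : 0 < r)
    (hd : Disjoint (ball a (2 * r)) (postOrbit lam))
    (hdiv : ∑' k, ∫⁻ z in (expMap lam)^[k] ⁻¹' ball a r, baseDensity z = ⊤) :
    Tendsto (fun n ↦ densitySum lam n a) atTop (𝓝 ⊤) := by
  have hsum := ENNReal.tendsto_nat_tsum
    fun k ↦ ∫⁻ z in (expMap lam)^[k] ⁻¹' ball a r, baseDensity z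
  rw [hdiv] at hsum
  set c := oscConst r * volume (ball a r)
  have hc : c ≠ ⊤ := ENNReal.mul_ne_top (oscConst_ne_top r) measure_ball_lt_top.ne
  have hsum' := ENNReal.Tendsto.mul_const (b := c⁻¹) hsum (Or.inl ENNReal.top_ne_zero)
  rw [ENNReal.top_mul (ENNReal.inv_ne_zero.2 hc)] at hsum'
  refine tendsto_nhds_top_mono hsum' (Eventually.of_forall fun n ↦ ?_)
  simp only [← div_eq_mul_inv]
  exact ENNReal.div_le_of_le_mul (sum_setLIntegral_baseDensity_le hlam hr hd n)

/-! ### Recurrence -/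

section Recurrence

variable {X : Type*} {f : X → X}

/-- The points whose orbit under `f` visits `B` infinitely often. -/
def recurrentSet (f : X → X) (B : Set X) : Set X := {z | ∃ᶠ n in atTop, f^[n] z ∈ B}

lemma preimage_recurrentSet (f : X → X) (B : Set X) :
    f ⁻¹' recurrentSet f B = recurrentSet f B := by
  ext z
  simp only [recurrentSet, mem_preimage, mem_ofPred_eq, ← Function.iterate_succ_apply]
  conv_rhs => rw [← map_add_atTop_eq_nat 1, frequently_map]

lemma iterate_mem_recurrentSet_iff {B : Set X} (n : ℕ) {z : X} :
    f^[n] z ∈ recurrentSet f B ↔ z ∈ recurrentSet f B :=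
  Set.ext_iff.1 (Function.IsFixedPt.preimage_iterate (preimage_recurrentSet f B) n) z

lemma disjoint_recurrentSet {B P : Set X} (hP : MapsTo f P P) (hB : Disjoint B P) :
    Disjoint (recurrentSet f B) P := by
  refine Set.disjoint_left.2 fun z hz hzP ↦ ?_
  obtain ⟨n, hn⟩ := Frequently.exists hz
  exact Set.disjoint_left.1 hB hn (hP.iterate n hzP)

variable [MeasurableSpace X]

lemma measurableSet_recurrentSet (hf : Measurable f) {B : Set X} (hB : MeasurableSet B) :
    MeasurableSet (recurrentSet f B) := by
  have hlimsup : recurrentSet f B = limsup (fun n ↦ f^[n] ⁻¹' B) atTop := by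
    ext z
    rw [mem_limsup_iff_frequently_mem]
    rfl
  rw [hlimsup]
  exact MeasurableSet.measurableSet_limsup fun n ↦ hf.iterate n hB

lemma top_mul_setLIntegral_le {μ : Measure X} (hf : Measurable f) {B : Set X}
    (hB : MeasurableSet B) {h : X → ENNReal} (hh : Measurable h) :
    ⊤ * ∫⁻ z in recurrentSet f B, h z ∂μ ≤ ∑' k, ∫⁻ z in f^[k] ⁻¹' B, h z ∂μ := by
  have hm : ∀ k, MeasurableSet (f^[k] ⁻¹' B) := fun k ↦ hf.iterate k hB
  simp only [← lintegral_indicator (hm _)]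
  rw [← lintegral_tsum fun k ↦ (hh.indicator (hm k)).aemeasurable, ← lintegral_const_mul _ hh,
    ← lintegral_indicator (measurableSet_recurrentSet hf hB)]
  refine lintegral_mono fun z ↦ ?_
  by_cases hz : z ∈ recurrentSet f B
  · rw [indicator_of_mem hz]
    rcases eq_or_ne (h z) 0 with h0 | h0
    · rw [h0, mul_zero]; exact zero_le
    have := (Nat.frequently_atTop_iff_infinite.1 hz).to_subtype
    have hvisits : ∑' k, (f^[k] ⁻¹' B).indicator h z =
        ∑' k, {k | f^[k] z ∈ B}.indicator (fun _ ↦ h z) k := rfl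
    rw [hvisits, ← tsum_subtype, ENNReal.tsum_const_eq_top_of_ne_zero h0]
    exact le_top
  · rw [indicator_of_notMem hz]; exact zero_le

end Recurrence

lemma transfer_iterate_le_of_transfer_le {v : ℂ → ENNReal} (h : transfer lam v ≤ v) (n : ℕ) :
    (transfer lam)^[n] v ≤ v := by
  induction n with
  | zero => exact le_rfl
  | succ n ih =>
    rw [Function.iterate_succ_apply']
    exact (transfer_mono ih).trans h

lemma transfer_iterate_add (g h : ℂ → ENNReal) (n : ℕ) :
    (transfer lam)^[n] (g + h) = (transfer lam)^[n] g + (transfer lam)^[n] h := by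
  induction n with
  | zero => rfl
  | succ n ih => simp only [Function.iterate_succ_apply', ih, transfer_add]

lemma sum_transfer_iterate_add {v d : ℂ → ENNReal} (h : v = d + transfer lam v) (n : ℕ) :
    ∑ k ∈ Finset.range n, (transfer lam)^[k] d + (transfer lam)^[n] v = v := by
  induction n with
  | zero => simp
  | succ n ih =>
    rw [Finset.sum_range_succ, add_assoc, Function.iterate_succ_apply, ← transfer_iterate_add, ← h,
      ih]

-- The defect `d = v - transfer lam v` satisfies `∑ transfer^[k] d ≤ v`, so it has a finite integral
-- over the visits to `B`, counted with multiplicity. Almost every point of its support would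
-- contribute infinitely often.
lemma transfer_ae_eq_of_le (hlam : lam ≠ 0) {B : Set ℂ} (hB : MeasurableSet B) {v : ℂ → ENNReal}
    (hv : Measurable v) (hle : transfer lam v ≤ v)
    (hsupp : ∀ z ∉ recurrentSet (expMap lam) B, v z = 0) (hfin : ∫⁻ x in B, v x ≠ ⊤) :
    transfer lam v =ᵐ[volume] v := by
  set d : ℂ → ENNReal := v - transfer lam v
  have hdm : Measurable d := hv.sub (measurable_transfer hv)
  have hvd : v = d + transfer lam v := (tsub_add_cancel_of_le hle).symm
  have hsum : ∑' k, ∫⁻ z in (expMap lam)^[k] ⁻¹' B, d z ≤ ∫⁻ x in B, v x := by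
    refine ENNReal.tsum_le_of_sum_range_le fun n ↦ ?_
    simp only [setLIntegral_preimage_iterate hlam hB hdm]
    rw [← lintegral_finsetSum _ fun k _ ↦ measurable_transfer_iterate hdm k]
    refine lintegral_mono fun x ↦ ?_
    have hx := congrFun (sum_transfer_iterate_add hvd n) x
    rw [Pi.add_apply, Finset.sum_apply] at hx
    exact hx ▸ le_self_add
  have hzero : ∫⁻ z in recurrentSet (expMap lam) B, d z = 0 := by
    by_contra hne
    have htop := (top_mul_setLIntegral_le (measurable_expMap lam) hB hdm).trans hsum
    rw [ENNReal.top_mul hne, top_le_iff] at htop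
    exact hfin htop
  rw [lintegral_eq_zero_iff hdm, EventuallyEq,
    ae_restrict_iff' (measurableSet_recurrentSet (measurable_expMap lam) hB)] at hzero
  filter_upwards [hzero] with z hz
  refine le_antisymm (hle z) ?_
  by_cases hzE : z ∈ recurrentSet (expMap lam) B
  · exact tsub_eq_zero_iff_le.1 (hz hzE)
  · rw [hsupp z hzE]; exact zero_le

lemma measurePreserving_withDensity (hlam : lam ≠ 0) {v : ℂ → ENNReal} (hv : Measurable v)
    (hinv : transfer lam v =ᵐ[volume] v) :
    MeasurePreserving (expMap lam) (volume.withDensity v) (volume.withDensity v) := by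
  refine ⟨measurable_expMap lam, Measure.ext fun A hA ↦ ?_⟩
  rw [Measure.map_apply (measurable_expMap lam) hA, withDensity_apply _ hA,
    withDensity_apply _ (measurable_expMap lam hA), setLIntegral_preimage hlam hA hv]
  exact lintegral_congr_ae (ae_restrict_of_ae hinv)

lemma isACInvariant_withDensity (hlam : lam ≠ 0) {v : ℂ → ENNReal} (hv : Measurable v)
    (hinv : transfer lam v =ᵐ[volume] v) (hne : ¬ v =ᵐ[volume] 0) :
    IsACInvariant (expMap lam) (volume.withDensity v) :=
  ⟨fun h0 ↦ hne ((withDensity_eq_zero_iff hv.aemeasurable).1 h0),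
    withDensity_absolutelyContinuous _ _, measurePreserving_withDensity hlam hv hinv⟩

lemma sigmaFinite_withDensity_of_transfer_le (hlam : lam ≠ 0) {B : Set ℂ} (hB : MeasurableSet B)
    {v : ℂ → ENNReal} (hv : Measurable v) (hle : transfer lam v ≤ v)
    (hsupp : ∀ z ∉ recurrentSet (expMap lam) B, v z = 0) (hfin : ∫⁻ x in B, v x ≠ ⊤) :
    SigmaFinite (volume.withDensity v) := by
  refine SigmaFinite.withDensity_of_ne_top ?_
  have hvisit : ∀ n : ℕ, ∀ᵐ x, x ∈ (expMap lam)^[n] ⁻¹' B → v x < ⊤ := by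
    intro n
    rw [← ae_restrict_iff' (measurable_iterate lam n hB)]
    refine ae_lt_top hv ?_
    rw [setLIntegral_preimage_iterate hlam hB hv]
    exact ne_top_of_le_ne_top hfin (lintegral_mono (transfer_iterate_le_of_transfer_le hle n))
  filter_upwards [ae_all_iff.2 hvisit] with x hx
  by_cases hxE : x ∈ recurrentSet (expMap lam) B
  · obtain ⟨n, hn⟩ := Frequently.exists hxE
    exact (hx n hn).ne
  · rw [hsupp x hxE]; exact ENNReal.zero_ne_top

lemma volume_inter_recurrentSet_ne_zero (hlam : lam ≠ 0) {B : Set ℂ} (hB : MeasurableSet B)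
    (hE : volume (recurrentSet (expMap lam) B) ≠ 0) :
    volume (B ∩ recurrentSet (expMap lam) B) ≠ 0 := by
  refine fun h0 ↦ hE (measure_mono_null (fun z hz ↦ ?_) (measure_iUnion_null fun n ↦
    volume_preimage_iterate_eq_zero hlam
      (hB.inter (measurableSet_recurrentSet (measurable_expMap lam) hB)) h0 n))
  obtain ⟨n, hn⟩ := Frequently.exists hz
  exact mem_iUnion.2 ⟨n, hn, (iterate_mem_recurrentSet_iff n).2 hz⟩

section RecurrentDisc

variable {a : ℂ} {r : ℝ}

lemma limitDensity_le_oscConst (hlam : lam ≠ 0)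
    (hd : Disjoint (ball a (2 * r)) (postOrbit lam)) {x : ℂ} (hx : x ∈ ball a r) :
    limitDensity lam a x ≤ oscConst r := by
  have hr : 0 < r := pos_of_mem_ball hx
  have ha : a ∉ postOrbit lam := Set.disjoint_left.1 hd (mem_ball_self (by positivity))
  simpa only [limitDensity_self hlam ha, mul_one] using
    limitDensity_le hlam a hd hx (mem_ball_self hr)

lemma limitDensity_ne_zero_of_mem_ball (hlam : lam ≠ 0)
    (hd : Disjoint (ball a (2 * r)) (postOrbit lam)) {x : ℂ} (hx : x ∈ ball a r) :
    limitDensity lam a x ≠ 0 := by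
  have hr : 0 < r := pos_of_mem_ball hx
  have ha : a ∉ postOrbit lam := Set.disjoint_left.1 hd (mem_ball_self (by positivity))
  intro h0
  have hle := limitDensity_le hlam a hd (mem_ball_self hr) hx
  rw [limitDensity_self hlam ha, h0, mul_zero] at hle
  exact one_ne_zero (le_antisymm hle zero_le)

lemma setLIntegral_indicator_limitDensity_ne_top (hlam : lam ≠ 0)
    (hd : Disjoint (ball a (2 * r)) (postOrbit lam)) (E : Set ℂ) :
    ∫⁻ x in ball a r, E.indicator (limitDensity lam a) x ≠ ⊤ := by
  refine ne_top_of_le_ne_top ?_ (setLIntegral_mono' (g := fun _ ↦ oscConst r) measurableSet_ball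
    fun x hx ↦ (indicator_le_self _ _ x).trans (limitDensity_le_oscConst hlam hd hx))
  rw [setLIntegral_const]
  exact ENNReal.mul_ne_top (oscConst_ne_top r) measure_ball_lt_top.ne

lemma tendsto_densitySum_of_recurrentSet (hlam : lam ≠ 0) (hr : 0 < r)
    (hd : Disjoint (ball a (2 * r)) (postOrbit lam))
    (hE : volume (recurrentSet (expMap lam) (ball a r)) ≠ 0) :
    Tendsto (fun n ↦ densitySum lam n a) atTop (𝓝 ⊤) := by
  refine tendsto_densitySum hlam hr hd ?_
  have htop := top_mul_setLIntegral_le (μ := volume) (measurable_expMap lam)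
    (measurableSet_ball (x := a) (ε := r)) measurable_baseDensity
  rwa [ENNReal.top_mul, top_le_iff] at htop
  refine ((setLIntegral_pos_iff measurable_baseDensity).2 ?_).ne'
  rwa [Function.support_eq_univ fun z ↦ (baseDensity_pos z).ne', univ_inter, pos_iff_ne_zero]

lemma transfer_indicator_limitDensity_le (hlam : lam ≠ 0)
    (ha : Tendsto (fun n ↦ densitySum lam n a) atTop (𝓝 ⊤)) {E : Set ℂ}
    (hE : expMap lam ⁻¹' E = E) (hEP : Disjoint E (postOrbit lam)) :
    transfer lam (E.indicator (limitDensity lam a)) ≤ E.indicator (limitDensity lam a) := by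
  rw [transfer_indicator hlam hE]
  intro x
  by_cases hx : x ∈ E
  · simp only [indicator_of_mem hx]
    exact transfer_limitDensity_le hlam ha (Set.disjoint_left.1 hEP hx)
  · simp only [indicator_of_notMem hx, le_refl]

theorem exists_isACInvariant_of_recurrentSet (hlam : lam ≠ 0) (hr : 0 < r)
    (hd : Disjoint (ball a (2 * r)) (postOrbit lam))
    (hE : volume (recurrentSet (expMap lam) (ball a r)) ≠ 0) :
    ∃ μ : Measure ℂ, SigmaFinite μ ∧ IsACInvariant (expMap lam) μ := by
  set E := recurrentSet (expMap lam) (ball a r)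
  have hEm : MeasurableSet E :=
    measurableSet_recurrentSet (measurable_expMap lam) measurableSet_ball
  have hEP : Disjoint E (postOrbit lam) := disjoint_recurrentSet (mapsTo_expMap_postOrbit lam)
    (hd.mono_left (ball_subset_ball (by linarith)))
  have hv : Measurable (E.indicator (limitDensity lam a)) :=
    (measurable_limitDensity lam a).indicator hEm
  have hle := transfer_indicator_limitDensity_le hlam
    (tendsto_densitySum_of_recurrentSet hlam hr hd hE) (preimage_recurrentSet _ _) hEP
  have hsupp : ∀ z ∉ E, E.indicator (limitDensity lam a) z = 0 :=
    fun z hz ↦ indicator_of_notMem hz _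
  have hfin := setLIntegral_indicator_limitDensity_ne_top hlam hd E
  refine ⟨_, sigmaFinite_withDensity_of_transfer_le hlam measurableSet_ball hv hle hsupp hfin,
    isACInvariant_withDensity hlam hv
      (transfer_ae_eq_of_le hlam measurableSet_ball hv hle hsupp hfin) fun h0 ↦
      volume_inter_recurrentSet_ne_zero hlam measurableSet_ball hE ?_⟩
  refine measure_mono_null (fun x hx ↦ ?_) (ae_iff.1 h0)
  rw [mem_ofPred_eq, indicator_of_mem hx.2]
  exact limitDensity_ne_zero_of_mem_ball hlam hd hx.1

end RecurrentDisc

/-! ### Limit points outside the post-singular set -/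

lemma coe_mem_omegaLimitSet_iff {f : ℂ → ℂ} {z p : ℂ} :
    (p : OnePoint ℂ) ∈ omegaLimitSet f z ↔ MapClusterPt p atTop fun n ↦ f^[n] z := by
  rw [omegaLimitSet, mem_omegaLimit_iff_frequently, mapClusterPt_iff_frequently]
  simp only [singleton_inter_nonempty, mem_preimage, OnePoint.nhds_coe_eq, mem_map]
  refine ⟨fun h U hU ↦ ?_, fun h U hU ↦ h _ hU⟩
  simpa [OnePoint.coe_injective.mem_set_image] using
    h ((↑) '' U) (by rwa [preimage_image_eq _ OnePoint.coe_injective])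

lemma coe_mem_postSingularSet_iff {p : ℂ} :
    (p : OnePoint ℂ) ∈ postSingularSet lam ↔ p ∈ postOrbit lam := by
  simp only [postSingularSet, mem_insert_iff, OnePoint.coe_ne_infty, false_or, postOrbit]
  exact OnePoint.coe_injective.mem_set_image

lemma not_omegaLimitSet_subset_iff {z : ℂ} :
    ¬ omegaLimitSet (expMap lam) z ⊆ postSingularSet lam ↔
      ∃ p ∉ postOrbit lam, MapClusterPt p atTop fun n ↦ (expMap lam)^[n] z := by
  rw [not_subset]
  constructor
  · rintro ⟨y, hy, hyP⟩
    induction y using OnePoint.rec with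
    | infty => exact absurd (mem_insert _ _) hyP
    | coe p =>
      exact ⟨p, fun h ↦ hyP (coe_mem_postSingularSet_iff.2 h), coe_mem_omegaLimitSet_iff.1 hy⟩
  · rintro ⟨p, hp, hc⟩
    exact ⟨p, coe_mem_omegaLimitSet_iff.2 hc, fun h ↦ hp (coe_mem_postSingularSet_iff.1 h)⟩

lemma exists_recurrentSet_ne_zero
    (h : 0 < volume {z : ℂ | ¬ omegaLimitSet (expMap lam) z ⊆ postSingularSet lam}) :
    ∃ a r, 0 < r ∧ Disjoint (ball a (2 * r)) (postOrbit lam) ∧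
      volume (recurrentSet (expMap lam) (ball a r)) ≠ 0 := by
  by_contra! hcon
  refine h.ne' (measure_mono_null (t := ⋃ (i : ℕ) (m : ℕ) (_ : Disjoint
    (ball (TopologicalSpace.denseSeq ℂ i) (2 * (1 / ((m : ℝ) + 1)))) (postOrbit lam)),
      recurrentSet (expMap lam) (ball (TopologicalSpace.denseSeq ℂ i) (1 / ((m : ℝ) + 1)))) ?_ ?_)
  · intro z hz
    obtain ⟨p, hp, hc⟩ := not_omegaLimitSet_subset_iff.1 hz
    obtain ⟨r, hr, hd⟩ := exists_ball_disjoint_postOrbit hp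
    obtain ⟨m, hm⟩ := exists_nat_one_div_lt (show (0 : ℝ) < 2 * r / 3 by positivity)
    have hm0 : (0 : ℝ) < 1 / ((m : ℝ) + 1) := by positivity
    obtain ⟨i, hi⟩ := (TopologicalSpace.denseRange_denseSeq ℂ).exists_dist_lt p hm0
    simp only [mem_iUnion]
    refine ⟨i, m, hd.mono_left (ball_subset_ball' ?_), ?_⟩
    · rw [dist_comm]; linarith
    · exact mapClusterPt_iff_frequently.1 hc _ (isOpen_ball.mem_nhds hi)
  · exact measure_iUnion_null fun i ↦ measure_iUnion_null fun m ↦ measure_iUnion_null fun hd ↦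
      hcon _ _ (by positivity) hd

theorem exists_sigmaFinite_isACInvariant (hlam : lam ≠ 0)
    (h : 0 < volume {z : ℂ | ¬ omegaLimitSet (expMap lam) z ⊆ postSingularSet lam}) :
    ∃ μ : Measure ℂ, SigmaFinite μ ∧ IsACInvariant (expMap lam) μ := by
  obtain ⟨a, r, hr, hd, hE⟩ := exists_recurrentSet_ne_zero h
  exact exists_isACInvariant_of_recurrentSet hlam hr hd hE

/-! ### Comparison of preimages -/

lemma IsInverseBranch.norm_deriv_iterate_le {φ : ℂ → ℂ} {a : ℂ} {R : ℝ} {F : ℂ → ℂ}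
    (h : IsInverseBranch F φ a R) (hF : Differentiable ℂ F) {x y : ℂ} (hx : x ∈ ball a (R / 2))
    (hy : y ∈ ball a (R / 2)) :
    ‖deriv F (φ x)‖ ≤ distortionConst * ‖deriv F (φ y)‖ := by
  have hsub : ball a (R / 2) ⊆ ball a R :=
    ball_subset_ball (by linarith [nonempty_ball.1 ⟨x, hx⟩])
  have hinv_x := h.norm_deriv_mul hF (hsub hx)
  have hinv_y := h.norm_deriv_mul hF (hsub hy)
  have hpos : 0 < ‖deriv φ y‖ := norm_pos_iff.2 (h.deriv_ne_zero hF (hsub hy))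
  refine le_of_mul_le_mul_right ?_ hpos
  rw [mul_assoc, hinv_y, mul_one]
  calc ‖deriv F (φ x)‖ * ‖deriv φ y‖
      ≤ ‖deriv F (φ x)‖ * (distortionConst * ‖deriv φ x‖) := by
        gcongr
        exact h.norm_deriv_le hF hy hx
    _ = distortionConst * (‖deriv F (φ x)‖ * ‖deriv φ x‖) := by ring
    _ = distortionConst := by rw [hinv_x, mul_one]

/-- Every iterated preimage of a point of `S` has a companion among the iterated preimages of `b`,
at a distance and with a derivative that are comparable uniformly in the number of iterates. -/
def PullbackComparable (lam : ℂ) (S : Set ℂ) (b : ℂ) : Prop :=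
  ∃ K > 0, ∀ x ∈ S, ∀ n w, (expMap lam)^[n] w = x → ∃ w', (expMap lam)^[n] w' = b ∧
    ‖w' - w‖ * ‖deriv (expMap lam)^[n] w'‖ ≤ K ∧
    ‖deriv (expMap lam)^[n] w'‖ ≤ K * ‖deriv (expMap lam)^[n] w‖

lemma pullbackComparable_ball (hlam : lam ≠ 0) {a : ℂ} {r : ℝ} (hr : 0 < r)
    (hd : Disjoint (ball a (2 * r)) (postOrbit lam)) {y : ℂ} (hy : y ∈ ball a r) :
    PullbackComparable lam (ball a r) y := by
  have hK := distortionConst_pos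
  refine ⟨distortionConst * (2 * r + 1), by positivity, fun x hx n w hw ↦ ?_⟩
  have hsub : ball a r ⊆ ball a (2 * r) := ball_subset_ball (by linarith)
  have hhalf : ball a r = ball a (2 * r / 2) := by congr 1; ring
  have hF := differentiable_iterate lam n
  obtain ⟨φ, hφ, rfl⟩ := exists_inverseBranch hlam hd n (hsub hx) hw
  refine ⟨φ y, hφ.right_inv y (hsub hy), ?_, ?_⟩
  · have hdist := hφ.norm_sub_le_mul hF (hhalf ▸ hy) (hhalf ▸ hx) (hhalf ▸ hy)
    have hinv := hφ.norm_deriv_mul hF (hsub hy)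
    have hxy : ‖y - x‖ ≤ 2 * r := by
      rw [← dist_eq_norm]
      have := dist_triangle_right y x a
      rw [mem_ball] at hx hy
      linarith
    calc ‖φ y - φ x‖ * ‖deriv (expMap lam)^[n] (φ y)‖
        ≤ distortionConst * ‖deriv φ y‖ * ‖y - x‖ * ‖deriv (expMap lam)^[n] (φ y)‖ := by gcongr
      _ = distortionConst * ‖y - x‖ * (‖deriv (expMap lam)^[n] (φ y)‖ * ‖deriv φ y‖) := by ring
      _ = distortionConst * ‖y - x‖ := by rw [hinv, mul_one]
      _ ≤ distortionConst * (2 * r + 1) := by gcongr; linarith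
  · refine (hφ.norm_deriv_iterate_le hF (hhalf ▸ hy) (hhalf ▸ hx)).trans ?_
    have : distortionConst ≤ distortionConst * (2 * r + 1) :=
      le_mul_of_one_le_right hK.le (by linarith)
    gcongr

lemma PullbackComparable.trans {S : Set ℂ} {b c : ℂ} (hb : PullbackComparable lam S b)
    (hc : PullbackComparable lam {b} c) : PullbackComparable lam S c := by
  obtain ⟨K, hK, hb⟩ := hb
  obtain ⟨M, hM, hc⟩ := hc
  refine ⟨M + M * K, by positivity, fun x hx n w hw ↦ ?_⟩
  obtain ⟨w1, hw1, hdist1, hder1⟩ := hb x hx n w hw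
  obtain ⟨w2, hw2, hdist2, hder2⟩ := hc b rfl n w1 hw1
  refine ⟨w2, hw2, ?_, ?_⟩
  · calc ‖w2 - w‖ * ‖deriv (expMap lam)^[n] w2‖
        ≤ (‖w2 - w1‖ + ‖w1 - w‖) * ‖deriv (expMap lam)^[n] w2‖ := by
          gcongr
          exact norm_sub_le_norm_sub_add_norm_sub _ _ _
      _ = ‖w2 - w1‖ * ‖deriv (expMap lam)^[n] w2‖ +
          ‖w1 - w‖ * ‖deriv (expMap lam)^[n] w2‖ := by ring
      _ ≤ M + ‖w1 - w‖ * (M * ‖deriv (expMap lam)^[n] w1‖) := by gcongr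
      _ = M + M * (‖w1 - w‖ * ‖deriv (expMap lam)^[n] w1‖) := by ring
      _ ≤ M + M * K := by gcongr
  · calc _ ≤ M * ‖deriv (expMap lam)^[n] w1‖ := hder2
      _ ≤ M * (K * ‖deriv (expMap lam)^[n] w‖) := by gcongr
      _ ≤ (M + M * K) * ‖deriv (expMap lam)^[n] w‖ := by
          have := norm_nonneg (deriv (expMap lam)^[n] w)
          nlinarith

lemma PullbackComparable.mono {S T : Set ℂ} {b : ℂ} (h : PullbackComparable lam T b)
    (hST : S ⊆ T) : PullbackComparable lam S b := by
  obtain ⟨K, hK, h⟩ := h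
  exact ⟨K, hK, fun x hx ↦ h x (hST hx)⟩

lemma pullbackComparable_of_isPreconnected (hlam : lam ≠ 0)
    (hconn : IsPreconnected (postOrbit lam)ᶜ) {a b : ℂ} (ha : a ∉ postOrbit lam)
    (hb : b ∉ postOrbit lam) : PullbackComparable lam {a} b := by
  refine hconn.induction₂' (fun x y ↦ PullbackComparable lam {x} y) (fun x hx ↦ ?_)
    (fun _ _ _ _ _ _ ↦ PullbackComparable.trans) ha hb
  obtain ⟨r, hr, hd⟩ := exists_ball_disjoint_postOrbit hx
  refine nhdsWithin_le_nhds ?_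
  filter_upwards [ball_mem_nhds x hr] with y hy
  exact ⟨(pullbackComparable_ball hlam hr hd hy).mono (singleton_subset_iff.2 (mem_ball_self hr)),
    (pullbackComparable_ball hlam hr hd (mem_ball_self hr)).mono (singleton_subset_iff.2 hy)⟩

lemma le_norm_deriv_iterate (hlam : lam ≠ 0) {a : ℂ} {R : ℝ} (hR : 0 < R)
    (hd : Disjoint (ball a R) (postOrbit lam)) {n : ℕ} (hn : 1 ≤ n) {w : ℂ}
    (hw : (expMap lam)^[n] w = a) : R / 640 ≤ ‖deriv (expMap lam)^[n] w‖ := by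
  obtain ⟨n, rfl⟩ := Nat.exists_eq_add_of_le' hn
  obtain ⟨φ, hφ, rfl⟩ := exists_inverseBranch hlam hd (n + 1) (mem_ball_self hR) hw
  have hinv := hφ.norm_deriv_mul (differentiable_iterate lam (n + 1)) (mem_ball_self hR)
  rw [div_le_iff₀ (by norm_num)]
  calc R = ‖deriv (expMap lam)^[n + 1] (φ a)‖ * (‖deriv φ a‖ * R) := by
        rw [← mul_assoc, hinv, one_mul]
    _ ≤ ‖deriv (expMap lam)^[n + 1] (φ a)‖ * 640 := by
        gcongr
        exact hφ.norm_deriv_mul_le hR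

lemma exists_period_norm_gt (C : ℝ) :
    ∃ k : ℤ, C < ‖(k * (2 * Real.pi * Complex.I) : ℂ)‖ := by
  obtain ⟨k, hk⟩ := exists_nat_gt C
  refine ⟨k, ?_⟩
  have : ‖((k : ℤ) * (2 * Real.pi * Complex.I) : ℂ)‖ = k * (2 * Real.pi) := by
    simp [abs_of_pos Real.pi_pos]
  rw [this]
  nlinarith [Real.pi_gt_three, (Nat.cast_nonneg k : (0 : ℝ) ≤ k)]

lemma exists_norm_bound (hb : Bornology.IsBounded (forwardOrbit (expMap lam) 0)) :
    ∃ ρ > 0, ∀ z ∈ postOrbit lam, ‖z‖ ≤ ρ :=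
  hb.closure.exists_pos_norm_le

-- The branch through `v` covers a disc about `v` on which `f^[n]` avoids the post-singular set,
-- whereas `f^[n] u` is a forward image of `f b`.
lemma div_le_dist_mul_norm_deriv_iterate (hlam : lam ≠ 0) {b : ℂ} {s : ℝ} (hs : 0 < s)
    (hd : Disjoint (ball b s) (postOrbit lam)) (hfb : expMap lam b ∈ postOrbit lam) {m n : ℕ}
    (hmn : m < n) {u v : ℂ} (hu : (expMap lam)^[m] u = b) (hv : (expMap lam)^[n] v = b) :
    s / 640 ≤ dist u v * ‖deriv (expMap lam)^[n] v‖ := by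
  obtain ⟨φ, hφ, rfl⟩ := exists_inverseBranch hlam hd n (mem_ball_self hs) hv
  have hinv := hφ.norm_deriv_mul (differentiable_iterate lam n) (mem_ball_self hs)
  suffices h : ‖deriv φ b‖ * s / 640 ≤ dist u (φ b) by
    calc s / 640
        = ‖deriv φ b‖ * s / 640 * ‖deriv (expMap lam)^[n] (φ b)‖ := by
          linear_combination -(s / 640) * hinv
      _ ≤ dist u (φ b) * ‖deriv (expMap lam)^[n] (φ b)‖ := by gcongr
  by_contra! hlt
  obtain ⟨y, hy, rfl⟩ := ball_subset_image_ball_of_injOn hs hφ.diff hφ.injOn (mem_ball.2 hlt)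
  obtain ⟨k, rfl⟩ := Nat.exists_eq_add_of_lt hmn
  have hy_mem : y ∈ postOrbit lam := by
    rw [← hφ.right_inv y hy, show m + k + 1 = k + 1 + m by lia, Function.iterate_add_apply, hu,
      Function.iterate_succ_apply]
    exact (mapsTo_expMap_postOrbit lam).iterate k hfb
  exact Set.disjoint_left.1 hd hy hy_mem

lemma exists_lt_norm_deriv_iterate_of_isBounded (hlam : lam ≠ 0) {b : ℂ} (hb : b ∉ postOrbit lam)
    (hfb : expMap lam b ∈ postOrbit lam) {n : ℕ → ℕ} (hn : ∀ k, k ≤ n k) {w : ℕ → ℂ}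
    (hw : ∀ k, (expMap lam)^[n k] (w k) = b) {C : ℝ} (hC : ∀ k, ‖w k‖ ≤ C) (M : ℝ) :
    ∃ k, M < ‖deriv (expMap lam)^[n k] (w k)‖ := by
  by_contra! hM
  obtain ⟨s, hs, hd⟩ := exists_ball_disjoint_postOrbit hb
  obtain ⟨q, -, θ, hθ, hlim⟩ := tendsto_subseq_of_bounded isBounded_closedBall
    fun k ↦ mem_closedBall_zero_iff.2 (hC k)
  have hsep : ∀ i j, n i < n j → s / 640 ≤ dist (w i) (w j) * M := fun i j hij ↦
    (div_le_dist_mul_norm_deriv_iterate hlam hs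
      (hd.mono_left (ball_subset_ball (by linarith))) hfb hij (hw i) (hw j)).trans
      (by gcongr; exact hM j)
  have hnear : ∀ i, ∀ᶠ j in atTop, s / 640 ≤ dist (w i) (w (θ j)) * M := fun i ↦ by
    filter_upwards [eventually_gt_atTop (n i)] with j hj
    exact hsep _ _ (hj.trans_le (hθ.le_apply.trans (hn _)))
  have hle : ∀ i, s / 640 ≤ dist (w (θ i)) q * M := fun i ↦
    ge_of_tendsto ((tendsto_const_nhds.dist hlim).mul_const M) (hnear (θ i))
  have hzero : Tendsto (fun i ↦ dist (w (θ i)) q * M) atTop (𝓝 0) := by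
    simpa only [dist_self, zero_mul, Function.comp_apply] using
      (Tendsto.dist hlim (tendsto_const_nhds (x := q))).mul_const M
  have := ge_of_tendsto' hzero hle
  linarith

-- Preimages of `a` are compared with preimages of some `b ∈ 2πiℤ` outside the post-singular set;
-- there `f b = f 0` is post-singular.
lemma exists_lt_norm_deriv_iterate (hlam : lam ≠ 0)
    (hb : Bornology.IsBounded (forwardOrbit (expMap lam) 0))
    (hconn : IsPreconnected (postOrbit lam)ᶜ) {a : ℂ} (ha : a ∉ postOrbit lam) (M C : ℝ) :
    ∃ N, ∀ n ≥ N, ∀ w, (expMap lam)^[n] w = a → ‖w‖ ≤ C →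
      M < ‖deriv (expMap lam)^[n] w‖ := by
  by_contra! hcon
  choose n hn w hw hwC hwM using hcon
  obtain ⟨ρ, -, hPρ⟩ := exists_norm_bound hb
  obtain ⟨k, hk⟩ := exists_period_norm_gt ρ
  set b : ℂ := k * (2 * Real.pi * Complex.I) with hb_def
  have hbP : b ∉ postOrbit lam := fun h ↦ (hPρ b h).not_gt hk
  have hfb : expMap lam b ∈ postOrbit lam := by
    have hfb0 := expMap_add_int_mul lam 0 k
    rw [zero_add, ← hb_def] at hfb0
    exact hfb0 ▸ iterate_zero_mem_postOrbit lam 1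
  obtain ⟨s, hs, hsd⟩ := exists_ball_disjoint_postOrbit hbP
  obtain ⟨K, hK, hcomp⟩ := pullbackComparable_of_isPreconnected hlam hconn ha hbP
  choose w' hw' hdist hder using fun N ↦ hcomp a rfl (n N) (w N) (hw N)
  have hbdd : ∀ N, ‖w' (N + 1)‖ ≤ C + K / (2 * s / 640) := by
    intro N
    have hlow := le_norm_deriv_iterate hlam (by positivity) hsd
      (show 1 ≤ n (N + 1) from le_trans (by lia) (hn (N + 1))) (hw' (N + 1))
    have hsub : ‖w' (N + 1) - w (N + 1)‖ ≤ K / (2 * s / 640) := by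
      rw [le_div_iff₀ (by positivity)]
      exact le_trans (by gcongr) (hdist (N + 1))
    linarith [hwC (N + 1), norm_le_norm_add_norm_sub' (w' (N + 1)) (w (N + 1))]
  obtain ⟨N, hN⟩ := exists_lt_norm_deriv_iterate_of_isBounded hlam hbP hfb
    (fun N ↦ N.le_succ.trans (hn (N + 1))) (fun N ↦ hw' (N + 1)) hbdd (K * M)
  exact hN.not_ge ((hder (N + 1)).trans (by gcongr; exact hwM (N + 1)))

/-! ### Density points -/

lemma exists_mem_tendsto_density {E : Set ℂ} (hE : MeasurableSet E) (hE0 : volume E ≠ 0) :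
    ∃ z ∈ E, Tendsto (fun r ↦ volume (E ∩ closedBall z r) / volume (closedBall z r))
      (𝓝[>] 0) (𝓝 1) := by
  have hdensity := Besicovitch.ae_tendsto_measure_inter_div volume E
  rw [ae_restrict_iff' hE] at hdensity
  by_contra! hcon
  exact hE0 (measure_eq_zero_iff_ae_notMem.2
    (hdensity.mono fun z hz hzE ↦ hcon z hzE (hz hzE)))

lemma eventually_inter_nonempty_of_tendsto_density {X : Type*} [PseudoMetricSpace X]
    [MeasurableSpace X] [OpensMeasurableSpace X] {μ : Measure X} {A : Set X}
    (hA : MeasurableSet A) {z : X}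
    (hz : Tendsto (fun r ↦ μ (A ∩ closedBall z r) / μ (closedBall z r)) (𝓝[>] 0) (𝓝 1))
    {q : ENNReal} (hq : q ≠ 0) :
    ∀ᶠ ρ in 𝓝[>] 0, ∀ S ⊆ closedBall z ρ, q ≤ μ S / μ (closedBall z ρ) → (S ∩ A).Nonempty := by
  have hlt : ∀ᶠ ρ in 𝓝[>] 0, 1 < q + μ (A ∩ closedBall z ρ) / μ (closedBall z ρ) :=
    (tendsto_const_nhds.add hz).eventually (lt_mem_nhds (by
      rw [add_comm]; exact ENNReal.lt_add_right ENNReal.one_ne_top hq))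
  filter_upwards [hlt] with ρ hρ S hS hqS
  by_contra hne
  have hdisj : Disjoint S (A ∩ closedBall z ρ) :=
    (disjoint_iff_inter_eq_empty.2 (not_nonempty_iff_eq_empty.1 hne)).mono_right inter_subset_left
  refine hρ.not_ge ?_
  calc q + μ (A ∩ closedBall z ρ) / μ (closedBall z ρ)
      ≤ (μ S + μ (A ∩ closedBall z ρ)) / μ (closedBall z ρ) := by
        rw [ENNReal.add_div]
        gcongr
    _ = μ (S ∪ A ∩ closedBall z ρ) / μ (closedBall z ρ) := by
        rw [measure_union hdisj (hA.inter measurableSet_closedBall)]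
    _ ≤ μ (closedBall z ρ) / μ (closedBall z ρ) := by
        gcongr
        exact union_subset hS inter_subset_right
    _ ≤ 1 := ENNReal.div_self_le_one

section InverseBranch

variable {F φ : ℂ → ℂ} {w : ℂ} {D : ℝ}

lemma IsInverseBranch.image_subset_closedBall (h : IsInverseBranch F φ w (2 * D))
    (hF : Differentiable ℂ F) (hD : 0 < D) {z : ℂ} {κ : ℝ} (hz : ‖φ w - z‖ ≤ κ * ‖deriv φ w‖) :
    φ '' ball w D ⊆ closedBall z ((κ + distortionConst * D) * ‖deriv φ w‖) := by
  have hK := distortionConst_pos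
  have hhalf : ball w D = ball w (2 * D / 2) := by congr 1; ring
  rintro _ ⟨x, hx, rfl⟩
  have hdist := h.norm_sub_le_mul hF (hhalf ▸ hx) (hhalf ▸ mem_ball_self hD)
    (hhalf ▸ mem_ball_self hD)
  rw [mem_ball, dist_eq_norm] at hx
  rw [mem_closedBall, dist_eq_norm]
  calc ‖φ x - z‖ ≤ ‖φ x - φ w‖ + ‖φ w - z‖ := norm_sub_le_norm_sub_add_norm_sub _ _ _
    _ ≤ distortionConst * ‖deriv φ w‖ * ‖x - w‖ + κ * ‖deriv φ w‖ := add_le_add hdist hz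
    _ ≤ distortionConst * ‖deriv φ w‖ * D + κ * ‖deriv φ w‖ := by gcongr
    _ = (κ + distortionConst * D) * ‖deriv φ w‖ := by ring

lemma IsInverseBranch.ofReal_mul_volume_le (h : IsInverseBranch F φ w (2 * D))
    (hF : Differentiable ℂ F) (hD : 0 < D) {G : Set ℂ} (hG : MeasurableSet G)
    (hGD : G ⊆ ball w D) :
    ENNReal.ofReal ((‖deriv φ w‖ / distortionConst) ^ 2) * volume G ≤ volume (φ '' G) := by
  have hK := distortionConst_pos
  have hsub : ball w D ⊆ ball w (2 * D) := ball_subset_ball (by linarith)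
  have hhalf : ball w D = ball w (2 * D / 2) := by congr 1; ring
  have harea := lintegral_image_of_hasDerivAt hG (fun x hx ↦ h.hasDerivAt (hsub (hGD hx)))
    (h.injOn.mono (hGD.trans hsub)) (fun _ ↦ 1)
  simp only [lintegral_const, Measure.restrict_apply_univ, one_mul, mul_one] at harea
  rw [harea, ← setLIntegral_const]
  refine setLIntegral_mono' hG fun x hx ↦ ENNReal.ofReal_le_ofReal ?_
  refine pow_le_pow_left₀ (by positivity) ?_ 2
  rw [div_le_iff₀ hK, mul_comm]
  exact h.norm_deriv_le hF (hhalf ▸ mem_ball_self hD) (hhalf ▸ hGD hx)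

end InverseBranch

lemma exists_image_inter_nonempty {A : Set ℂ} (hA : MeasurableSet A) {z : ℂ}
    (hz : Tendsto (fun r ↦ volume (A ∩ closedBall z r) / volume (closedBall z r)) (𝓝[>] 0) (𝓝 1))
    {κ D : ℝ} (hκ : 0 ≤ κ) (hD : 0 < D) {m : ENNReal} (hm : m ≠ 0) :
    ∃ ε > 0, ∀ F φ : ℂ → ℂ, ∀ w, Differentiable ℂ F → IsInverseBranch F φ w (2 * D) →
      ‖φ w - z‖ ≤ κ * ‖deriv φ w‖ → ‖deriv φ w‖ < ε →
      ∀ G ⊆ ball w D, MeasurableSet G → m ≤ volume G → (φ '' G ∩ A).Nonempty := by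
  have hK := distortionConst_pos
  set κ' := κ + distortionConst * D
  have hκ' : 0 < κ' := by positivity
  set c := ENNReal.ofReal (distortionConst * κ') ^ 2 * NNReal.pi with hc
  have hc_ne_top : c ≠ ⊤ := by simp [hc, ENNReal.mul_eq_top]
  obtain ⟨ε, hε, hball⟩ := Metric.mem_nhdsWithin_iff.1
    (eventually_inter_nonempty_of_tendsto_density hA hz (q := m / c)
      (ENNReal.div_pos hm hc_ne_top).ne')
  refine ⟨ε / κ', by positivity, fun F φ w hF hφ hφz hφε G hGD hG hmG ↦ ?_⟩
  have hδ : 0 < ‖deriv φ w‖ :=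
    norm_pos_iff.2 (hφ.deriv_ne_zero hF (mem_ball_self (by positivity)))
  set ρ := κ' * ‖deriv φ w‖ with hρ_def
  have hρ : 0 < ρ := by positivity
  have hρε : ρ < ε := by rwa [hρ_def, mul_comm, ← lt_div_iff₀ hκ']
  refine hball ⟨by rwa [mem_ball, dist_zero_right, Real.norm_of_nonneg hρ.le], hρ⟩ (φ '' G)
    ((image_mono hGD).trans (hφ.image_subset_closedBall hF hD hφz)) ?_
  have hvol := hφ.ofReal_mul_volume_le hF hD hG hGD
  have hscale : ENNReal.ofReal ((‖deriv φ w‖ / distortionConst) ^ 2) * c =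
      volume (closedBall z ρ) := by
    rw [Complex.volume_closedBall, hc, ← mul_assoc, ← ENNReal.ofReal_pow (by positivity),
      ← ENNReal.ofReal_pow hρ.le, ← ENNReal.ofReal_mul (by positivity), hρ_def]
    congr 2
    field_simp
  have hs0 : ENNReal.ofReal ((‖deriv φ w‖ / distortionConst) ^ 2) ≠ 0 :=
    (ENNReal.ofReal_pos.2 (by positivity)).ne'
  rw [← hscale, ← ENNReal.mul_div_mul_left _ c hs0 ENNReal.ofReal_ne_top]
  gcongr
  exact (mul_le_mul_right hmG _).trans hvol

/-! ### Ergodicity -/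

section Ergodicity

variable {a : ℂ} {r : ℝ}

lemma exists_inverseBranch_near_recurrentSet (hlam : lam ≠ 0)
    (hb : Bornology.IsBounded (forwardOrbit (expMap lam) 0))
    (hconn : IsPreconnected (postOrbit lam)ᶜ) (hr : 0 < r)
    (hd : Disjoint (ball a (2 * r)) (postOrbit lam)) {b : ℂ} {R : ℝ} (hR : 0 < R)
    (hbR : Disjoint (ball b R) (postOrbit lam)) :
    ∃ K > 0, ∀ z ∈ recurrentSet (expMap lam) (ball a r), ∀ ε > 0, ∃ n φ,
      IsInverseBranch (expMap lam)^[n] φ b R ∧ ‖φ b - z‖ ≤ K * ‖deriv φ b‖ ∧ ‖deriv φ b‖ < ε := by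
  have haP : a ∉ postOrbit lam := Set.disjoint_left.1 hd (mem_ball_self (by positivity))
  have hbP : b ∉ postOrbit lam := Set.disjoint_left.1 hbR (mem_ball_self hR)
  obtain ⟨K, hK, hcomp⟩ := (pullbackComparable_ball hlam hr hd (mem_ball_self hr)).trans
    (pullbackComparable_of_isPreconnected hlam hconn haP hbP)
  refine ⟨K, hK, fun z hz ε hε ↦ ?_⟩
  obtain ⟨N, hN⟩ := exists_lt_norm_deriv_iterate hlam hb hconn hbP (1 / ε)
    (‖z‖ + K / (R / 640))
  obtain ⟨n, hn, hnB⟩ := (frequently_atTop.1 hz) (max N 1)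
  obtain ⟨w, hw, hwd, -⟩ := hcomp _ hnB n z rfl
  have hlow := le_norm_deriv_iterate hlam hR hbR (le_trans (le_max_right _ _) hn) hw
  have hpos : 0 < ‖deriv (expMap lam)^[n] w‖ := lt_of_lt_of_le (by positivity) hlow
  have hwz : ‖w - z‖ ≤ K / (R / 640) := by
    rw [le_div_iff₀ (by positivity)]
    exact le_trans (by gcongr) hwd
  have hbig : 1 / ε < ‖deriv (expMap lam)^[n] w‖ := hN n (le_trans (le_max_left _ _) hn) w hw
    (by linarith [norm_le_norm_add_norm_sub' w z])
  obtain ⟨φ, hφ, rfl⟩ := exists_inverseBranch hlam hbR n (mem_ball_self hR) hw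
  have hinv : ‖deriv φ b‖ = 1 / ‖deriv (expMap lam)^[n] (φ b)‖ := by
    rw [eq_div_iff hpos.ne', mul_comm]
    exact hφ.norm_deriv_mul (differentiable_iterate lam n) (mem_ball_self hR)
  refine ⟨n, φ, hφ, ?_, ?_⟩
  · rwa [hinv, mul_one_div, le_div_iff₀ hpos]
  · rwa [hinv, div_lt_comm₀ hpos hε]

lemma volume_ball_diff_recurrentSet (hlam : lam ≠ 0)
    (hb : Bornology.IsBounded (forwardOrbit (expMap lam) 0))
    (hconn : IsPreconnected (postOrbit lam)ᶜ) (hr : 0 < r)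
    (hd : Disjoint (ball a (2 * r)) (postOrbit lam))
    (hE : volume (recurrentSet (expMap lam) (ball a r)) ≠ 0) {b : ℂ} {s : ℝ} (hs : 0 < s)
    (hbs : Disjoint (ball b (2 * s)) (postOrbit lam)) :
    volume (ball b s \ recurrentSet (expMap lam) (ball a r)) = 0 := by
  set E := recurrentSet (expMap lam) (ball a r)
  have hEm : MeasurableSet E :=
    measurableSet_recurrentSet (measurable_expMap lam) measurableSet_ball
  by_contra hpos
  obtain ⟨z, hzE, hz⟩ := exists_mem_tendsto_density hEm hE
  obtain ⟨K, hK, hbranch⟩ :=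
    exists_inverseBranch_near_recurrentSet hlam hb hconn hr hd (by positivity) hbs
  obtain ⟨ε, hε, hdens⟩ := exists_image_inter_nonempty hEm hz hK.le hs hpos
  obtain ⟨n, φ, hφ, hφz, hφε⟩ := hbranch z hzE ε hε
  obtain ⟨_, ⟨y, hy, rfl⟩, hyE⟩ := hdens _ φ b (differentiable_iterate lam n) hφ hφz hφε
    (ball b s \ E) sdiff_subset (measurableSet_ball.diff hEm) le_rfl
  have hfE := (iterate_mem_recurrentSet_iff n).2 hyE
  rw [hφ.right_inv y (ball_subset_ball (by linarith) hy.1)] at hfE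
  exact hy.2 hfE

lemma volume_compl_diff_recurrentSet (hlam : lam ≠ 0)
    (hb : Bornology.IsBounded (forwardOrbit (expMap lam) 0))
    (hconn : IsPreconnected (postOrbit lam)ᶜ) (hr : 0 < r)
    (hd : Disjoint (ball a (2 * r)) (postOrbit lam))
    (hE : volume (recurrentSet (expMap lam) (ball a r)) ≠ 0) :
    volume ((postOrbit lam)ᶜ \ recurrentSet (expMap lam) (ball a r)) = 0 := by
  refine measure_null_of_locally_null _ fun b hbs ↦ ?_
  obtain ⟨s, hs, hsd⟩ := exists_ball_disjoint_postOrbit hbs.1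
  exact ⟨ball b s \ recurrentSet (expMap lam) (ball a r),
    mem_nhdsWithin.2 ⟨ball b s, isOpen_ball, mem_ball_self hs, fun x hx ↦ ⟨hx.1, hx.2.2⟩⟩,
    volume_ball_diff_recurrentSet hlam hb hconn hr hd hE hs hsd⟩

-- A large translation by a period moves the bounded post-singular set off itself, into points that
-- are mapped into it and hence are not recurrent.
lemma volume_postOrbit_eq_zero (hlam : lam ≠ 0)
    (hb : Bornology.IsBounded (forwardOrbit (expMap lam) 0))
    (hconn : IsPreconnected (postOrbit lam)ᶜ) (hr : 0 < r)
    (hd : Disjoint (ball a (2 * r)) (postOrbit lam))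
    (hE : volume (recurrentSet (expMap lam) (ball a r)) ≠ 0) : volume (postOrbit lam) = 0 := by
  obtain ⟨ρ, -, hPρ⟩ := exists_norm_bound hb
  obtain ⟨k, hk⟩ := exists_period_norm_gt (2 * ρ)
  have hEP : Disjoint (recurrentSet (expMap lam) (ball a r)) (postOrbit lam) :=
    disjoint_recurrentSet (mapsTo_expMap_postOrbit lam)
      (hd.mono_left (ball_subset_ball (by linarith)))
  rw [← measure_preimage_add_right volume (k * (2 * Real.pi * Complex.I))]
  refine measure_mono_null (fun x hx ↦ ?_)
    (volume_compl_diff_recurrentSet hlam hb hconn hr hd hE)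
  have hx' : x + k * (2 * Real.pi * Complex.I) ∈ postOrbit lam := hx
  refine ⟨fun hxP ↦ ?_, fun hxE ↦ ?_⟩
  · have hsub := norm_sub_le (x + k * (2 * Real.pi * Complex.I)) x
    rw [add_sub_cancel_left] at hsub
    linarith [hPρ _ hx', hPρ _ hxP]
  · have hfx : expMap lam x ∈ postOrbit lam := by
      rw [← expMap_add_int_mul lam x k]
      exact mapsTo_expMap_postOrbit lam hx'
    rw [← preimage_recurrentSet] at hxE
    exact Set.disjoint_left.1 hEP hxE hfx

end Ergodicity

/-! ### Connectedness of the complement of the post-singular set -/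

section Normality

variable {f : ℂ → ℂ} {x : ℂ} {s C : ℝ}

lemma norm_iterate_sub_le_of_bounded (hf : Differentiable ℂ f) (hs : 0 < s)
    (hC : ∀ n, ∀ z ∈ closedBall x (2 * s), ‖f^[n] z‖ ≤ C) (n : ℕ) {y z : ℂ}
    (hy : y ∈ closedBall x s) (hz : z ∈ closedBall x s) :
    ‖f^[n] z - f^[n] y‖ ≤ C / s * ‖z - y‖ := by
  refine (convex_closedBall x s).norm_image_sub_le_of_norm_deriv_le
    (fun w _ ↦ (hf.iterate n) w) (fun w hw ↦ ?_) hy hz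
  refine Complex.norm_deriv_le_of_forall_mem_sphere_norm_le hs (hf.iterate n).diffContOnCl
    fun u hu ↦ hC n u (closedBall_subset_closedBall' ?_ (sphere_subset_closedBall hu))
  rw [mem_closedBall] at hw
  linarith

lemma iteratesNormalOn_of_bounded (hf : Differentiable ℂ f) (hs : 0 < s)
    (hC : ∀ n, ∀ z ∈ closedBall x (2 * s), ‖f^[n] z‖ ≤ C) : IteratesNormalOn f (ball x s) := by
  classical
  intro n
  have : CompactSpace (closedBall x s) := isCompact_iff_compactSpace.1 (isCompact_closedBall x s)
  let F : ℕ → BoundedContinuousFunction (closedBall x s) ℂ := fun j ↦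
    BoundedContinuousFunction.mkOfCompact
      ⟨fun z ↦ f^[n j] z, (hf.iterate (n j)).continuous.comp continuous_subtype_val⟩
  have hcomp : IsCompact (closure (range F)) := by
    refine BoundedContinuousFunction.arzela_ascoli (closedBall 0 C) (isCompact_closedBall 0 C)
      (range F) ?_ ?_
    · rintro _ z ⟨j, rfl⟩
      rw [mem_closedBall_zero_iff]
      exact hC (n j) z (closedBall_subset_closedBall (by linarith) z.2)
    · refine Metric.equicontinuous_of_continuity_modulus (fun t ↦ C / s * t) ?_ _ ?_
      · simpa only [mul_zero] using (continuous_const_mul (C / s)).tendsto 0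
      · rintro y z ⟨_, j, rfl⟩
        rw [dist_eq_norm, Subtype.dist_eq, dist_eq_norm]
        exact norm_iterate_sub_le_of_bounded hf hs hC (n j) z.2 y.2
  obtain ⟨g, -, k, hk, hlim⟩ := hcomp.tendsto_subseq (x := F) fun j ↦ subset_closure ⟨j, rfl⟩
  refine ⟨k, hk, Or.inl ⟨fun z ↦ if h : z ∈ closedBall x s then g ⟨z, h⟩ else 0, ?_⟩⟩
  rw [BoundedContinuousFunction.tendsto_iff_tendstoUniformly] at hlim
  refine (TendstoUniformlyOn.mono ?_ ball_subset_closedBall).tendstoLocallyUniformlyOn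
  rw [Metric.tendstoUniformlyOn_iff]
  intro ε hε
  filter_upwards [Metric.tendstoUniformly_iff.1 hlim ε hε] with j hj z hz
  rw [dif_pos hz]
  exact hj ⟨z, hz⟩

end Normality

lemma isPreconnected_lt_norm {ρ : ℝ} (hρ : 0 < ρ) : IsPreconnected {z : ℂ | ρ < ‖z‖} := by
  have himage : {z : ℂ | ρ < ‖z‖} = Complex.exp '' {z | Real.log ρ < z.re} := by
    ext z
    constructor
    · intro (hz : ρ < ‖z‖)
      refine ⟨Complex.log z, ?_, Complex.exp_log (norm_pos_iff.1 (hρ.trans hz))⟩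
      rw [mem_ofPred_eq, Complex.log_re]
      exact Real.log_lt_log hρ hz
    · rintro ⟨w, hw, rfl⟩
      rw [mem_ofPred_eq, Complex.norm_exp]
      exact (Real.log_lt_iff_lt_exp hρ).1 hw
  rw [himage]
  exact (convex_halfSpace_re_gt _).isPreconnected.image _ Complex.continuous_exp.continuousOn

lemma frontier_connectedComponentIn_subset {X : Type*} [TopologicalSpace X]
    [LocallyConnectedSpace X] {U : Set X} (hU : IsOpen U) (x : X) :
    frontier (connectedComponentIn U x) ⊆ Uᶜ := by
  intro y hy hyU
  obtain ⟨u, hu, hux⟩ := mem_closure_iff.1 (frontier_subset_closure hy) _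
    (hU.connectedComponentIn (x := y)) (mem_connectedComponentIn hyU)
  have hcomp : connectedComponentIn U y = connectedComponentIn U x :=
    (connectedComponentIn_eq hu).trans (connectedComponentIn_eq hux).symm
  exact Set.disjoint_left.1 (disjoint_frontier_iff_isOpen.2 hU.connectedComponentIn) hy
    (hcomp ▸ mem_connectedComponentIn hyU)

lemma isPreconnected_compl_of_exists_lt_norm {P : Set ℂ} {ρ : ℝ} (hρ : 0 < ρ)
    (hP : ∀ z ∈ P, ‖z‖ ≤ ρ) (h : ∀ x ∉ P, ∃ z ∈ connectedComponentIn Pᶜ x, ρ < ‖z‖) :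
    IsPreconnected Pᶜ := by
  refine isPreconnected_of_forall_pair fun x hx y hy ↦ ?_
  obtain ⟨u, hux, hu⟩ := h x hx
  obtain ⟨v, hvy, hv⟩ := h y hy
  have hvu : v ∈ connectedComponentIn Pᶜ u :=
    (isPreconnected_lt_norm hρ).subset_connectedComponentIn hu
      (fun z hz hzP ↦ (hP z hzP).not_gt hz) hv
  have hxy : connectedComponentIn Pᶜ x = connectedComponentIn Pᶜ y :=
    (connectedComponentIn_eq hux).trans
      ((connectedComponentIn_eq hvu).trans (connectedComponentIn_eq hvy).symm)
  exact ⟨_, connectedComponentIn_subset _ _, mem_connectedComponentIn hx,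
    hxy ▸ mem_connectedComponentIn hy, isPreconnected_connectedComponentIn⟩

-- By the maximum principle the iterates are bounded, hence normal, on a bounded complementary
-- component.
lemma isPreconnected_compl_postOrbit (hJ : juliaSet (expMap lam) = univ)
    (hb : Bornology.IsBounded (forwardOrbit (expMap lam) 0)) :
    IsPreconnected (postOrbit lam)ᶜ := by
  obtain ⟨ρ, hρ, hPρ⟩ := exists_norm_bound hb
  have hopen : IsOpen (postOrbit lam)ᶜ := (isClosed_postOrbit lam).isOpen_compl
  refine isPreconnected_compl_of_exists_lt_norm hρ hPρ fun x hx ↦ ?_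
  by_contra! hV
  have hbd : ∀ n, ∀ z ∈ connectedComponentIn (postOrbit lam)ᶜ x, ‖(expMap lam)^[n] z‖ ≤ ρ := by
    refine fun n z hz ↦ Complex.norm_le_of_forall_mem_frontier_norm_le
      (isBounded_closedBall.subset fun z hz ↦ mem_closedBall_zero_iff.2 (hV z hz))
      (differentiable_iterate lam n).diffContOnCl (fun y hy ↦ hPρ _ ?_) (subset_closure hz)
    have hyP := frontier_connectedComponentIn_subset hopen x hy
    exact (mapsTo_expMap_postOrbit lam).iterate n (not_notMem.1 hyP)
  obtain ⟨ε, hε, hεV⟩ :=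
    Metric.isOpen_iff.1 hopen.connectedComponentIn x (mem_connectedComponentIn hx)
  have hnormal : IteratesNormalOn (expMap lam) (ball x (ε / 4)) :=
    iteratesNormalOn_of_bounded (differentiable_expMap lam) (by positivity)
      fun n z hz ↦ hbd n z (hεV (closedBall_subset_ball (by linarith) hz))
  have hxJ : x ∈ juliaSet (expMap lam) := hJ ▸ mem_univ x
  exact hxJ ⟨_, isOpen_ball, mem_ball_self (by positivity), hnormal⟩

/-! ### Non-existence of invariant probabilities -/

-- Otherwise preimages of `B` of arbitrarily small `baseDensity`-mass would have `μ`-mass `μ B`,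
-- against the uniform integrability of the density of `μ`.
lemma IsACInvariant.exists_pos_le_setLIntegral_baseDensity {f : ℂ → ℂ} {μ : Measure ℂ}
    [IsFiniteMeasure μ] (hμ : IsACInvariant f μ) {B : Set ℂ} (hB : MeasurableSet B)
    (hB0 : μ B ≠ 0) : ∃ δ > 0, ∀ k, δ ≤ ∫⁻ z in f^[k] ⁻¹' B, baseDensity z := by
  set γ : Measure ℂ := volume.withDensity baseDensity
  have : IsFiniteMeasure γ := isFiniteMeasure_withDensity lintegral_baseDensity_lt_top.ne
  have hac : μ ≪ γ := hμ.ac.trans (withDensity_absolutelyContinuous'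
    measurable_baseDensity.aemeasurable (Eventually.of_forall fun z ↦ (baseDensity_pos z).ne'))
  obtain ⟨δ, hδ, hsmall⟩ := exists_pos_setLIntegral_lt_of_measure_lt
    (Measure.lintegral_rnDeriv_lt_top μ γ).ne hB0
  refine ⟨δ, hδ, fun k ↦ ?_⟩
  have hinv := hμ.invariant.iterate k
  by_contra! hlt
  rw [← withDensity_apply _ (hinv.measurable hB)] at hlt
  have hself := hsmall _ hlt
  rw [Measure.setLIntegral_rnDeriv hac, hinv.measure_preimage hB.nullMeasurableSet] at hself
  exact lt_irrefl _ hself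

lemma lintegral_densitySum (hlam : lam ≠ 0) (n : ℕ) :
    ∫⁻ x, densitySum lam n x = n * ∫⁻ z, baseDensity z := by
  simp only [densitySum_apply]
  rw [lintegral_finsetSum _ fun k _ ↦ measurable_transfer_iterate measurable_baseDensity k]
  simp [lintegral_transfer_iterate hlam measurable_baseDensity]

lemma lintegral_limitDensity_ne_top (hlam : lam ≠ 0) {a : ℂ} {r : ℝ} (hr : 0 < r)
    (hd : Disjoint (ball a (2 * r)) (postOrbit lam)) {δ : ENNReal} (hδ : δ ≠ 0)
    (hlow : ∀ k, δ ≤ ∫⁻ z in (expMap lam)^[k] ⁻¹' ball a r, baseDensity z) :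
    ∫⁻ z, limitDensity lam a z ≠ ⊤ := by
  have ha : a ∉ postOrbit lam := Set.disjoint_left.1 hd (mem_ball_self (by positivity))
  set c := oscConst r * volume (ball a r)
  have hc : c ≠ ⊤ := ENNReal.mul_ne_top (oscConst_ne_top r) measure_ball_lt_top.ne
  have hδtop : δ ≠ ⊤ := ne_top_of_le_ne_top
    ((setLIntegral_le_lintegral _ _).trans_lt lintegral_baseDensity_lt_top).ne (hlow 0)
  have hlinear : ∀ n : ℕ, n * δ ≤ densitySum lam n a * c := fun n ↦ by
    refine le_trans ?_ (sum_setLIntegral_baseDensity_le hlam hr hd n)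
    simpa using Finset.card_nsmul_le_sum (Finset.range n) _ δ fun k _ ↦ hlow k
  have hbound : ∫⁻ z, limitDensity lam a z ≤ (∫⁻ z, baseDensity z) * (c * δ⁻¹) := by
    refine (lintegral_liminf_le fun n ↦ (measurable_densitySum n).mul_const _).trans ?_
    rw [← liminf_const (f := (atTop : Filter ℕ)) ((∫⁻ z, baseDensity z) * (c * δ⁻¹))]
    refine liminf_le_liminf ?_
    filter_upwards [eventually_ge_atTop 1] with n hn
    obtain ⟨n, rfl⟩ := Nat.exists_eq_add_of_le' hn
    rw [lintegral_mul_const _ (measurable_densitySum _), lintegral_densitySum hlam,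
      mul_comm ((n + 1 : ℕ) : ENNReal), mul_assoc]
    refine mul_le_mul_right ?_ _
    rw [← div_eq_mul_inv, ← div_eq_mul_inv,
      ENNReal.div_le_iff (densitySum_succ_ne_zero n a) (densitySum_ne_top hlam ha _),
      ENNReal.mul_comm_div, mul_comm c, ← ENNReal.mul_div_right_comm,
      ENNReal.le_div_iff_mul_le (Or.inl hδ) (Or.inl hδtop)]
    exact hlinear (n + 1)
  exact ne_top_of_le_ne_top (ENNReal.mul_ne_top lintegral_baseDensity_lt_top.ne
    (ENNReal.mul_ne_top hc (ENNReal.inv_ne_top.2 hδ))) hbound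

lemma exists_limitDensity_invariant (hlam : lam ≠ 0) (hP : volume (postOrbit lam) = 0)
    {μ : Measure ℂ} [IsFiniteMeasure μ] (hμ : IsACInvariant (expMap lam) μ) :
    ∃ a ∉ postOrbit lam, ∫⁻ z, limitDensity lam a z ≠ ⊤ ∧
      transfer lam (limitDensity lam a) =ᵐ[volume] limitDensity lam a := by
  have hμP : μ (postOrbit lam)ᶜ ≠ 0 := fun h0 ↦ hμ.ne_zero <| Measure.measure_univ_eq_zero.1 <| by
    rw [← union_compl_self (postOrbit lam), measure_union_null (hμ.ac hP) h0]
  obtain ⟨a, haP, ha⟩ := exists_mem_forall_mem_nhdsWithin_pos_measure hμP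
  obtain ⟨r, hr, hd⟩ := exists_ball_disjoint_postOrbit haP
  obtain ⟨δ, hδ, hlow⟩ := hμ.exists_pos_le_setLIntegral_baseDensity measurableSet_ball
    (ha _ (mem_nhdsWithin_of_mem_nhds (ball_mem_nhds a hr))).ne'
  have hlim := tendsto_densitySum hlam hr hd <| top_le_iff.1 <|
    (ENNReal.tsum_const_eq_top_of_ne_zero (α := ℕ) hδ.ne').symm.le.trans
      (ENNReal.tsum_le_tsum hlow)
  have hfin := lintegral_limitDensity_ne_top hlam hr hd hδ.ne' hlow
  have hle : transfer lam (limitDensity lam a) ≤ᵐ[volume] limitDensity lam a := by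
    filter_upwards [compl_mem_ae_iff.2 hP] with x hx
    exact transfer_limitDensity_le hlam hlim hx
  have hvm := measurable_limitDensity lam a
  have heq : ∫⁻ x, transfer lam (limitDensity lam a) x = ∫⁻ x, limitDensity lam a x :=
    lintegral_transfer_iterate hlam hvm 1
  exact ⟨a, haP, hfin, ae_eq_of_ae_le_of_lintegral_le hle (heq ▸ hfin) hvm.aemeasurable heq.ge⟩

lemma limitDensity_ne_zero (hlam : lam ≠ 0) (hconn : IsPreconnected (postOrbit lam)ᶜ) {a x : ℂ}
    (ha : a ∉ postOrbit lam) (hx : x ∉ postOrbit lam) : limitDensity lam a x ≠ 0 := by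
  refine hconn.induction₂' (fun x y ↦ limitDensity lam a x ≠ 0 → limitDensity lam a y ≠ 0)
    (fun x hx ↦ ?_) (fun x y z _ _ _ hxy hyz h ↦ hyz (hxy h)) ha hx
    (by rw [limitDensity_self hlam ha]; exact one_ne_zero)
  obtain ⟨r, hr, hd⟩ := exists_ball_disjoint_postOrbit hx
  have hzero : ∀ {y z}, y ∈ ball x r → z ∈ ball x r →
      limitDensity lam a y ≠ 0 → limitDensity lam a z ≠ 0 := fun hy hz hne h0 ↦ hne <| by
    simpa only [h0, mul_zero, nonpos_iff_eq_zero] using limitDensity_le hlam a hd hy hz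
  refine nhdsWithin_le_nhds ?_
  filter_upwards [ball_mem_nhds x hr] with y hy
  exact ⟨hzero (mem_ball_self hr) hy, hzero hy (mem_ball_self hr)⟩

/-- The translations `j * (π / 2) * I`, `j < 4`, which rotate the values of the exponential by the
powers of `I`; they are used to compare the masses of half-planes. -/
noncomputable def quarterPeriod (j : Fin 4) : ℂ := (j : ℕ) * (Real.pi / 2 * Complex.I)

lemma norm_quarterPeriod_lt (j : Fin 4) : ‖quarterPeriod j‖ < 5 := by
  have hj : ((j : ℕ) : ℝ) ≤ 3 := by exact_mod_cast Nat.le_of_lt_succ j.isLt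
  have hnorm : ‖quarterPeriod j‖ = (j : ℕ) * (Real.pi / 2) := by
    simp [quarterPeriod, abs_of_pos Real.pi_pos]
  rw [hnorm]
  nlinarith [Real.pi_lt_d2, Real.pi_pos]

lemma expMap_add_quarterPeriod (lam z : ℂ) (j : Fin 4) :
    expMap lam (z + quarterPeriod j) = expMap lam z * Complex.I ^ (j : ℕ) := by
  rw [expMap, expMap, quarterPeriod, Complex.exp_add, Complex.exp_nat_mul,
    Complex.exp_pi_div_two_mul_I, mul_assoc]

lemma exists_lt_re_mul_I_pow {w : ℂ} {t : ℝ} (hw : 2 * t < ‖w‖) :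
    ∃ j : Fin 4, t < (w * Complex.I ^ (j : ℕ)).re := by
  by_contra! h
  have hre : w.re ≤ t := by simpa using h 0
  have him_neg : -w.im ≤ t := by simpa using h 1
  have hre_neg : -w.re ≤ t := by simpa using h 2
  have him : w.im ≤ t := by simpa [Complex.I_pow_three] using h 3
  have hnorm : ‖w‖ ≤ |w.re| + |w.im| := Complex.norm_le_abs_re_add_abs_im w
  linarith [abs_le'.2 ⟨hre, hre_neg⟩, abs_le'.2 ⟨him, him_neg⟩]

lemma exists_lt_re_expMap_add_quarterPeriod {z : ℂ} {t : ℝ}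
    (hz : 2 * t < ‖expMap lam z‖) : ∃ j, t < (expMap lam (z + quarterPeriod j)).re := by
  simpa only [expMap_add_quarterPeriod] using exists_lt_re_mul_I_pow hz

lemma exists_re_expMap_add_quarterPeriod_lt {z : ℂ} {t : ℝ}
    (hz : 2 * t < ‖expMap lam z‖) : ∃ j, (expMap lam (z + quarterPeriod j)).re < -t := by
  obtain ⟨j, hj⟩ := exists_lt_re_mul_I_pow (hz.trans_eq (norm_neg _).symm)
  refine ⟨j, ?_⟩
  rw [neg_mul, Complex.neg_re] at hj
  rw [expMap_add_quarterPeriod]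
  linarith

lemma disjoint_ball_postOrbit_of_le_re {ρ R : ℝ} (hPρ : ∀ z ∈ postOrbit lam, ‖z‖ ≤ ρ) {z : ℂ}
    (hz : ρ + R ≤ z.re) : Disjoint (ball z R) (postOrbit lam) := by
  refine Set.disjoint_left.2 fun y hy hyP ↦ ?_
  have htri := norm_le_norm_add_norm_sub' z y
  rw [mem_ball, dist_comm, dist_eq_norm] at hy
  linarith [hPρ y hyP, Complex.re_le_norm z]

lemma measurableSet_lt_re (s : ℝ) : MeasurableSet {z : ℂ | s < z.re} :=
  measurableSet_lt measurable_const Complex.measurable_re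

lemma measurableSet_re_lt (s : ℝ) : MeasurableSet {z : ℂ | z.re < s} :=
  measurableSet_lt Complex.measurable_re measurable_const

lemma setLIntegral_le_of_quarterPeriod (hlam : lam ≠ 0) (a : ℂ) {ρ s : ℝ}
    (hPρ : ∀ z ∈ postOrbit lam, ‖z‖ ≤ ρ) (hs : ρ + 10 ≤ s) {G : Set ℂ} (hG : MeasurableSet G)
    (hGs : ∀ z, s < z.re → ∃ j, z + quarterPeriod j ∈ G) :
    ∫⁻ z in {z : ℂ | s < z.re}, limitDensity lam a z ≤
      4 * oscConst 5 * ∫⁻ z in G, limitDensity lam a z := by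
  have hvm := measurable_limitDensity lam a
  set D : Fin 4 → Set ℂ := fun j ↦ {z : ℂ | s < z.re} ∩ (fun z ↦ z + quarterPeriod j) ⁻¹' G
  have hpart : ∀ j, ∫⁻ z in D j, limitDensity lam a z ≤
      oscConst 5 * ∫⁻ z in G, limitDensity lam a z := fun j ↦
    calc ∫⁻ z in D j, limitDensity lam a z
        ≤ ∫⁻ z in D j, oscConst 5 * limitDensity lam a (z + quarterPeriod j) := by
          refine setLIntegral_mono' ((measurableSet_lt_re s).inter ((measurable_add_const _) hG))
            fun z hz ↦ limitDensity_le hlam a (b := z) ?_ (mem_ball_self (by norm_num)) ?_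
          · exact disjoint_ball_postOrbit_of_le_re hPρ (by linarith [show s < z.re from hz.1])
          · rw [mem_ball, dist_eq_norm, add_sub_cancel_left]
            exact norm_quarterPeriod_lt j
      _ ≤ ∫⁻ z in (fun z ↦ z + quarterPeriod j) ⁻¹' G,
            oscConst 5 * limitDensity lam a (z + quarterPeriod j) :=
          lintegral_mono_set inter_subset_right
      _ = ∫⁻ z in G, oscConst 5 * limitDensity lam a z :=
          (measurePreserving_add_right volume (quarterPeriod j)).setLIntegral_comp_preimage hG
            (hvm.const_mul _)
      _ = _ := lintegral_const_mul _ hvm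
  calc ∫⁻ z in {z : ℂ | s < z.re}, limitDensity lam a z
      ≤ ∫⁻ z in ⋃ j, D j, limitDensity lam a z := lintegral_mono_set fun z hz ↦
        let ⟨j, hj⟩ := hGs z hz; mem_iUnion.2 ⟨j, hz, hj⟩
    _ ≤ ∑' j, ∫⁻ z in D j, limitDensity lam a z := lintegral_iUnion_le _ _
    _ ≤ ∑' _ : Fin 4, oscConst 5 * ∫⁻ z in G, limitDensity lam a z := ENNReal.tsum_le_tsum hpart
    _ = _ := by simp [mul_assoc]

lemma exists_pos_le_mul_max {α ℓ : ℝ → ℝ} {κ T : ℝ} (hanti : Antitone α) (hpos : ∀ t, 0 < α t)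
    (hκ : 0 < κ) (hT : 0 < T) (hα : ∀ t ≥ T, α (ℓ t) ≤ κ * α t) (hκℓ : ∀ t ≥ T, κ * ℓ t ≤ t)
    (hhalf : ∀ t ≥ T, 2 * ℓ t ≤ t) : ∃ A > 0, ∀ t, A ≤ α t * max t T := by
  set S := max T (κ * T)
  have hS : 0 < S := hT.trans_le (le_max_left _ _)
  have hbase : ∀ t ≤ S, T * α S ≤ α t * max t T := fun t ht ↦ by
    rw [mul_comm]
    exact mul_le_mul (hanti ht) (le_max_right _ _) hT.le (hpos t).le
  have hind : ∀ n : ℕ, ∀ t ≤ 2 ^ n * S, T * α S ≤ α t * max t T := by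
    intro n
    induction n with
    | zero => exact fun t ht ↦ hbase t (by simpa using ht)
    | succ n ih =>
      intro t ht
      rcases le_or_gt t S with htS | htS
      · exact hbase t htS
      have htT : T ≤ t := (le_max_left _ _).trans htS.le
      have hκmax : κ * max (ℓ t) T ≤ max t T := by
        rw [mul_max_of_nonneg _ _ hκ.le]
        exact (max_le (hκℓ t htT) ((le_max_right _ _).trans htS.le)).trans (le_max_left _ _)
      calc T * α S ≤ α (ℓ t) * max (ℓ t) T :=
            ih (ℓ t) (by rw [pow_succ] at ht; linarith [hhalf t htT])
        _ ≤ κ * α t * max (ℓ t) T := by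
            gcongr
            exact hα t htT
        _ = α t * (κ * max (ℓ t) T) := by ring
        _ ≤ α t * max t T := by gcongr; exact (hpos t).le
  refine ⟨T * α S, mul_pos hT (hpos S), fun t ↦ ?_⟩
  obtain ⟨n, hn⟩ := pow_unbounded_of_one_lt (t / S) one_lt_two
  exact hind n t ((div_lt_iff₀ hS).1 hn).le

lemma eventually_mul_log_le (c : ℝ) {L : ℝ} (hL : 0 < L) :
    ∀ᶠ t : ℝ in atTop, c * Real.log (2 * t / L) ≤ t := by
  have hlog : (fun t : ℝ ↦ c * Real.log (2 * t / L)) =o[atTop] fun t ↦ 2 / L * t := by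
    simpa only [Function.comp_def, id, mul_div_right_comm] using
      (Real.isLittleO_log_id_atTop.comp_tendsto
        (tendsto_id.const_mul_atTop (show 0 < 2 / L by positivity))).const_mul_left c
  filter_upwards [(hlog.trans_isBigO (Asymptotics.isBigO_const_mul_self _ _ _)).bound one_pos,
    eventually_ge_atTop 0] with t ht ht0
  rw [one_mul, Real.norm_of_nonneg ht0] at ht
  exact (Real.le_norm_self _).trans ht

lemma exists_le_mul_of_log_le {α β : ℝ → ℝ} (hanti : Antitone α) (hpos : ∀ t, 0 < α t)
    {κ L t₀ : ℝ} (hκ : 0 < κ) (hL : 0 < L)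
    (hα : ∀ t ≥ t₀, α (Real.log (2 * t / L)) ≤ κ * α t)
    (hβ : ∀ t ≥ t₀, α (Real.log (2 * t / L)) ≤ κ * β t) :
    ∃ A > 0, ∀ᶠ t in atTop, A ≤ β t * t := by
  have hev : ∀ᶠ t in atTop, 0 < t ∧ t₀ ≤ t ∧ κ * Real.log (2 * t / L) ≤ t ∧
      2 * Real.log (2 * t / L) ≤ t :=
    (eventually_gt_atTop 0).and <| (eventually_ge_atTop t₀).and <|
      (eventually_mul_log_le κ hL).and (eventually_mul_log_le 2 hL)
  obtain ⟨T, hT⟩ := eventually_atTop.1 hev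
  obtain ⟨A, hA, hlow⟩ := exists_pos_le_mul_max hanti hpos hκ (hT T le_rfl).1
    (fun t ht ↦ hα t (hT t ht).2.1) (fun t ht ↦ (hT t ht).2.2.1) fun t ht ↦ (hT t ht).2.2.2
  refine ⟨A, hA, ?_⟩
  filter_upwards [eventually_ge_atTop T, eventually_ge_atTop (κ * T)] with t htT htκ
  have hβt := hβ t (hT t htT).2.1
  have hβ0 : 0 ≤ β t := (pos_of_mul_pos_right ((hpos _).trans_le hβt) hκ.le).le
  calc A ≤ α (Real.log (2 * t / L)) * max (Real.log (2 * t / L)) T := hlow _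
    _ ≤ κ * β t * max (Real.log (2 * t / L)) T := by
        gcongr
        exact (hT T le_rfl).1.le.trans (le_max_right _ _)
    _ = β t * (κ * max (Real.log (2 * t / L)) T) := by ring
    _ ≤ β t * t := by
        rw [mul_max_of_nonneg _ _ hκ.le]
        gcongr
        exact max_le (hT t htT).2.2.1 htκ

lemma norm_expMap_sub_le {R : ℝ} {z w : ℂ} (hz : ‖z‖ ≤ R) (hw : ‖w‖ ≤ R) :
    ‖expMap lam z - expMap lam w‖ ≤ ‖lam‖ * Real.exp R * ‖z - w‖ := by
  refine (convex_closedBall (0 : ℂ) R).norm_image_sub_le_of_norm_hasDerivWithin_le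
    (fun x _ ↦ (hasDerivAt_expMap lam x).hasDerivWithinAt) (fun x hx ↦ ?_)
    (mem_closedBall_zero_iff.2 hw) (mem_closedBall_zero_iff.2 hz)
  rw [norm_expMap]
  gcongr
  exact (Complex.re_le_norm x).trans (mem_closedBall_zero_iff.1 hx)

lemma norm_iterate_le_of_norm_mul_pow_le {ρ Λ : ℝ} (hPρ : ∀ z ∈ postOrbit lam, ‖z‖ ≤ ρ)
    (hΛ : ‖lam‖ * Real.exp (ρ + 1) ≤ Λ) (hΛ1 : 1 ≤ Λ) {w : ℂ} {j : ℕ} (hw : ‖w‖ * Λ ^ j ≤ 1)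
    {i : ℕ} (hi : i ≤ j) : ‖(expMap lam)^[i] w‖ ≤ ρ + 1 := by
  have horbit : ∀ i, ‖(expMap lam)^[i] 0‖ ≤ ρ := fun i ↦ hPρ _ (iterate_zero_mem_postOrbit lam i)
  have hbound : ∀ i ≤ j, ‖(expMap lam)^[i] w - (expMap lam)^[i] 0‖ ≤ ‖w‖ * Λ ^ i →
      ‖(expMap lam)^[i] w‖ ≤ ρ + 1 := fun i hi hclose ↦ by
    have hpow : ‖w‖ * Λ ^ i ≤ 1 := le_trans (by gcongr) hw
    have htri := norm_le_norm_add_norm_sub' ((expMap lam)^[i] w) ((expMap lam)^[i] 0)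
    linarith [horbit i]
  have hclose : ∀ i ≤ j, ‖(expMap lam)^[i] w - (expMap lam)^[i] 0‖ ≤ ‖w‖ * Λ ^ i := by
    intro i
    induction i with
    | zero => simp
    | succ i ih =>
      intro hi
      have hprev := ih (Nat.le_of_succ_le hi)
      have hw' := hbound i (Nat.le_of_succ_le hi) hprev
      rw [Function.iterate_succ_apply', Function.iterate_succ_apply']
      calc _ ≤ ‖lam‖ * Real.exp (ρ + 1) * ‖(expMap lam)^[i] w - (expMap lam)^[i] 0‖ :=
            norm_expMap_sub_le hw' (by linarith [horbit i])
        _ ≤ Λ * (‖w‖ * Λ ^ i) := by gcongr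
        _ = ‖w‖ * Λ ^ (i + 1) := by ring
  exact hbound i hi (hclose i hi)

lemma sum_measureReal_le {X : Type*} [MeasurableSpace X] {f : X → X} {ν : Measure X}
    [IsFiniteMeasure ν] (hf : MeasurePreserving f ν ν) {A : ℕ → Set X} {L : Set X}
    (hA : ∀ j, MeasurableSet (A j)) (hAL : ∀ j, A j ⊆ L)
    (hret : ∀ j, ∀ z ∈ A j, ∀ i < j, f^[i + 1] z ∉ L) (N : ℕ) :
    ∑ j ∈ Finset.range N, ν.real (A j) ≤ ν.real univ := by
  have hpre : ∀ j, ν.real (A j) = ν.real (f^[N - j] ⁻¹' A j) := fun j ↦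
    ((hf.iterate (N - j)).measureReal_preimage (hA j).nullMeasurableSet).symm
  have hdisj : ∀ i < N, ∀ j < N, i < j → Disjoint (f^[N - i] ⁻¹' A i) (f^[N - j] ⁻¹' A j) := by
    refine fun i hi j hj hij ↦ Set.disjoint_left.2 fun w hwi hwj ↦
      hret j _ hwj (j - i - 1) (by lia) ?_
    rw [← Function.iterate_add_apply, show j - i - 1 + 1 + (N - j) = N - i by lia]
    exact hAL i hwi
  simp only [hpre]
  rw [← measureReal_biUnion_finset]
  · exact measureReal_mono (subset_univ _)
  · intro i hi j hj hij
    rw [Finset.coe_range, mem_Iio] at hi hj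
    rcases lt_or_gt_of_ne hij with hlt | hlt
    · exact hdisj i hi j hj hlt
    · exact (hdisj j hj i hi hlt).symm
  · exact fun j _ ↦ (hf.iterate (N - j)).measurable (hA j)

-- A point with `re z < -(j * log Λ + c)` is mapped so close to `0` that it then follows the bounded
-- orbit of `0`, hence stays away from the left half-plane, for at least `j` steps.
lemma sum_measureReal_re_lt_le {ν : Measure ℂ} [IsFiniteMeasure ν]
    (hinv : MeasurePreserving (expMap lam) ν ν) {ρ Λ c : ℝ}
    (hPρ : ∀ z ∈ postOrbit lam, ‖z‖ ≤ ρ) (hΛ : ‖lam‖ * Real.exp (ρ + 1) ≤ Λ) (hΛ1 : 1 ≤ Λ)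
    (hρc : ρ + 1 ≤ c) (hc : ‖lam‖ ≤ Real.exp c) (N : ℕ) :
    ∑ j ∈ Finset.range N, ν.real {z : ℂ | z.re < -(j * Real.log Λ + c)} ≤ ν.real univ := by
  have hlogΛ : 0 ≤ Real.log Λ := Real.log_nonneg hΛ1
  refine sum_measureReal_le hinv (A := fun j : ℕ ↦ {z : ℂ | z.re < -(j * Real.log Λ + c)})
    (L := {z | z.re < -(ρ + 1)}) (fun j ↦ measurableSet_re_lt _) (fun j z hz ↦ ?_)
    (fun j z hz i hi hmem ↦ ?_) N
  · have hj : 0 ≤ j * Real.log Λ := by positivity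
    rw [mem_ofPred_eq] at hz ⊢
    linarith
  · rw [mem_ofPred_eq] at hz
    have hsmall : ‖expMap lam z‖ * Λ ^ j ≤ 1 := by
      have hΛj : Λ ^ j = Real.exp (j * Real.log Λ) := by
        rw [Real.exp_nat_mul, Real.exp_log (one_pos.trans_le hΛ1)]
      calc ‖expMap lam z‖ * Λ ^ j = ‖lam‖ * Real.exp z.re * Real.exp (j * Real.log Λ) := by
            rw [norm_expMap, hΛj]
        _ ≤ Real.exp c * Real.exp (-(j * Real.log Λ + c)) * Real.exp (j * Real.log Λ) := by gcongr
        _ = 1 := by rw [← Real.exp_add, ← Real.exp_add, ← Real.exp_zero]; ring_nf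
    have hbound := norm_iterate_le_of_norm_mul_pow_le hPρ hΛ hΛ1 hsmall hi.le
    rw [mem_ofPred_eq, Function.iterate_succ_apply] at hmem
    linarith [neg_le_of_abs_le ((Complex.abs_re_le_norm _).trans hbound)]

lemma not_le_mul_of_sum_le {β : ℝ → ℝ} {A b c M : ℝ} (hA : 0 < A) (hb : 0 ≤ b) (hc : 0 < c)
    (hsum : ∀ N, ∑ j ∈ Finset.range N, β (j * b + c) ≤ M) : ¬ ∀ t ≥ c, A ≤ β t * t := by
  intro hlow
  have hterm : ∀ j : ℕ, A / (b + c) * (1 / ((j : ℝ) + 1)) ≤ β (j * b + c) := fun j ↦ by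
    have hj : 0 ≤ j * b := by positivity
    refine le_trans ?_ ((div_le_iff₀ (by positivity)).2 (hlow (j * b + c) (by linarith)))
    rw [div_mul_div_comm, mul_one]
    refine div_le_div_of_nonneg_left hA.le (by positivity) ?_
    nlinarith [(Nat.cast_nonneg j : (0 : ℝ) ≤ j)]
  have hdiv := Real.tendsto_sum_range_one_div_nat_succ_atTop.const_mul_atTop
    (show 0 < A / (b + c) by positivity)
  obtain ⟨N, hN⟩ := (hdiv.eventually (eventually_gt_atTop M)).exists
  rw [Finset.mul_sum] at hN
  exact (hN.trans_le (Finset.sum_le_sum fun j _ ↦ hterm j)).not_ge (hsum N)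

section IntegrableLimitDensity

variable {a : ℂ} {ρ : ℝ}

lemma exists_measureReal_lt_re_le (hlam : lam ≠ 0)
    (hfin : ∫⁻ z, limitDensity lam a z ≠ ⊤)
    (hinv : transfer lam (limitDensity lam a) =ᵐ[volume] limitDensity lam a)
    (hPρ : ∀ z ∈ postOrbit lam, ‖z‖ ≤ ρ) :
    ∃ κ > 0, ∀ s ≥ ρ + 10, ∀ U : Set ℂ, MeasurableSet U →
      (∀ z : ℂ, s < z.re → ∃ j, expMap lam (z + quarterPeriod j) ∈ U) →
      (volume.withDensity (limitDensity lam a)).real {z | s < z.re} ≤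
        κ * (volume.withDensity (limitDensity lam a)).real U := by
  have : IsFiniteMeasure (volume.withDensity (limitDensity lam a)) :=
    isFiniteMeasure_withDensity hfin
  have hκ : 4 * oscConst 5 ≠ ⊤ := ENNReal.mul_ne_top (by norm_num) (oscConst_ne_top 5)
  refine ⟨(4 * oscConst 5).toReal + 1, by positivity, fun s hs U hU hUs ↦ ?_⟩
  have hle := setLIntegral_le_of_quarterPeriod hlam a hPρ hs (measurable_expMap lam hU) hUs
  rw [← withDensity_apply _ (measurableSet_lt_re s),
    ← withDensity_apply _ (measurable_expMap lam hU),
    (measurePreserving_withDensity hlam (measurable_limitDensity lam a) hinv).measure_preimage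
      hU.nullMeasurableSet] at hle
  have hreal := ENNReal.toReal_mono (ENNReal.mul_ne_top hκ (measure_ne_top _ U)) hle
  rw [ENNReal.toReal_mul] at hreal
  exact hreal.trans (mul_le_mul_of_nonneg_right (le_add_of_nonneg_right zero_le_one)
    measureReal_nonneg)

lemma withDensity_limitDensity_lt_re_ne_zero (hlam : lam ≠ 0)
    (hconn : IsPreconnected (postOrbit lam)ᶜ) (ha : a ∉ postOrbit lam)
    (hPρ : ∀ z ∈ postOrbit lam, ‖z‖ ≤ ρ) (t : ℝ) :
    volume.withDensity (limitDensity lam a) {z | t < z.re} ≠ 0 := by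
  rw [withDensity_apply _ (measurableSet_lt_re t)]
  refine ((setLIntegral_pos_iff (measurable_limitDensity lam a)).2 ?_).ne'
  have hsub : {z : ℂ | max t ρ < z.re} ⊆
      Function.support (limitDensity lam a) ∩ {z | t < z.re} := fun z hz ↦ by
    obtain ⟨htz, hρz⟩ := max_lt_iff.1 (show max t ρ < z.re from hz)
    exact ⟨limitDensity_ne_zero hlam hconn ha fun hzP ↦
      (hρz.trans_le (Complex.re_le_norm z)).not_ge (hPρ z hzP), htz⟩
  refine lt_of_lt_of_le (IsOpen.measure_pos volume
    (isOpen_lt continuous_const Complex.continuous_re) ⟨((max t ρ + 1 : ℝ) : ℂ), ?_⟩)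
    (measure_mono hsub)
  rw [mem_ofPred_eq, Complex.ofReal_re]
  exact lt_add_one _

lemma exists_le_measureReal_re_lt_mul (hlam : lam ≠ 0) (hconn : IsPreconnected (postOrbit lam)ᶜ)
    (ha : a ∉ postOrbit lam) (hfin : ∫⁻ z, limitDensity lam a z ≠ ⊤)
    (hinv : transfer lam (limitDensity lam a) =ᵐ[volume] limitDensity lam a)
    (hPρ : ∀ z ∈ postOrbit lam, ‖z‖ ≤ ρ) :
    ∃ A > 0, ∀ᶠ t in atTop,
      A ≤ (volume.withDensity (limitDensity lam a)).real {z | z.re < -t} * t := by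
  have : IsFiniteMeasure (volume.withDensity (limitDensity lam a)) :=
    isFiniteMeasure_withDensity hfin
  have hL : 0 < ‖lam‖ := norm_pos_iff.2 hlam
  obtain ⟨κ, hκ, hcompare⟩ := exists_measureReal_lt_re_le hlam hfin hinv hPρ
  set t₀ : ℝ := ‖lam‖ / 2 * Real.exp (ρ + 10) with ht₀
  have hpos : ∀ t ≥ t₀, 0 < 2 * t / ‖lam‖ := fun t ht ↦ by
    have : 0 < t := lt_of_lt_of_le (by positivity) ht
    positivity
  have hlog : ∀ t ≥ t₀, ρ + 10 ≤ Real.log (2 * t / ‖lam‖) := fun t ht ↦ by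
    rw [Real.le_log_iff_exp_le (hpos t ht), le_div_iff₀ hL]
    rw [ht₀] at ht
    linarith
  have hlarge : ∀ t ≥ t₀, ∀ z : ℂ, Real.log (2 * t / ‖lam‖) < z.re → 2 * t < ‖expMap lam z‖ :=
    fun t ht z hz ↦ by
      rw [Real.log_lt_iff_lt_exp (hpos t ht), div_lt_iff₀ hL] at hz
      rwa [norm_expMap, mul_comm ‖lam‖]
  refine exists_le_mul_of_log_le
    (α := fun t ↦ (volume.withDensity (limitDensity lam a)).real {z | t < z.re})
    (fun s t hst ↦ measureReal_mono fun z (hz : t < z.re) ↦ lt_of_le_of_lt hst hz)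
    (fun t ↦ ENNReal.toReal_pos (withDensity_limitDensity_lt_re_ne_zero hlam hconn ha hPρ t)
      (measure_ne_top _ _)) hκ hL (t₀ := t₀) (fun t ht ↦ ?_) (fun t ht ↦ ?_)
  · exact hcompare _ (hlog t ht) _ (measurableSet_lt_re t) fun z hz ↦
      exists_lt_re_expMap_add_quarterPeriod (hlarge t ht z hz)
  · exact hcompare _ (hlog t ht) _ (measurableSet_re_lt _) fun z hz ↦
      exists_re_expMap_add_quarterPeriod_lt (hlarge t ht z hz)

end IntegrableLimitDensity

theorem not_exists_isACInvariant_probability (hlam : lam ≠ 0)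
    (hb : Bornology.IsBounded (forwardOrbit (expMap lam) 0))
    (hconn : IsPreconnected (postOrbit lam)ᶜ) (hP : volume (postOrbit lam) = 0) :
    ¬ ∃ μ : Measure ℂ, IsProbabilityMeasure μ ∧ IsACInvariant (expMap lam) μ := by
  rintro ⟨μ, _, hμ⟩
  obtain ⟨a, ha, hfin, hinv⟩ := exists_limitDensity_invariant hlam hP hμ
  obtain ⟨ρ, hρ, hPρ⟩ := exists_norm_bound hb
  have : IsFiniteMeasure (volume.withDensity (limitDensity lam a)) :=
    isFiniteMeasure_withDensity hfin
  obtain ⟨A, hA, hlow⟩ := exists_le_measureReal_re_lt_mul hlam hconn ha hfin hinv hPρ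
  obtain ⟨T, hT⟩ := eventually_atTop.1 hlow
  set c : ℝ := max (max (ρ + 1) T) ‖lam‖
  have hρc : ρ + 1 ≤ c := (le_max_left _ _).trans (le_max_left _ _)
  have hTc : T ≤ c := (le_max_right _ _).trans (le_max_left _ _)
  have hlamc : ‖lam‖ ≤ Real.exp c :=
    (le_max_right _ _).trans ((lt_add_one c).le.trans (Real.add_one_le_exp c))
  have hΛ1 : 1 ≤ max (‖lam‖ * Real.exp (ρ + 1)) 1 := le_max_right _ _
  exact not_le_mul_of_sum_le
    (β := fun t ↦ (volume.withDensity (limitDensity lam a)).real {z | z.re < -t}) hA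
    (Real.log_nonneg hΛ1) (by positivity)
    (sum_measureReal_re_lt_le (measurePreserving_withDensity hlam (measurable_limitDensity lam a)
      hinv) hPρ (le_max_left _ _) hΛ1 hρc hlamc) fun t ht ↦ hT t (hTc.trans ht)

/-! ### The escaping set -/

lemma exists_expMap_add_mul_I (lam w : ℂ) :
    ∃ θ : ℝ, |θ| ≤ 2 * Real.pi ∧
      ∀ h, expMap lam (w + θ * Complex.I + h) = -‖expMap lam w‖ * Complex.exp h := by
  set t := (expMap lam w).arg
  refine ⟨Real.pi - t, ?_, fun h ↦ ?_⟩
  · have ht := Complex.arg_mem_Ioc (expMap lam w)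
    rw [abs_le]
    constructor <;> linarith [ht.1, ht.2, Real.pi_pos]
  · calc expMap lam (w + ↑(Real.pi - t) * Complex.I + h)
        = expMap lam w * Complex.exp (↑(Real.pi - t) * Complex.I) * Complex.exp h := by
          simp only [expMap, Complex.exp_add, mul_assoc]
      _ = ‖expMap lam w‖ * Complex.exp (t * Complex.I) *
            Complex.exp (↑(Real.pi - t) * Complex.I) * Complex.exp h := by
          rw [Complex.norm_mul_exp_arg_mul_I]
      _ = ‖expMap lam w‖ * Complex.exp (Real.pi * Complex.I) * Complex.exp h := by
          rw [mul_assoc (‖expMap lam w‖ : ℂ), ← Complex.exp_add, ← add_mul, ← Complex.ofReal_add,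
            add_sub_cancel]
      _ = -‖expMap lam w‖ * Complex.exp h := by rw [Complex.exp_pi_mul_I, mul_neg_one]

lemma re_exp_pos {h : ℂ} (hh : ‖h‖ ≤ 1) : 0 < (Complex.exp h).re := by
  have him := abs_le.1 ((Complex.abs_im_le_norm h).trans hh)
  rw [Complex.exp_re]
  exact mul_pos (Real.exp_pos _) (Real.cos_pos_of_mem_Ioo
    ⟨by linarith [Real.pi_gt_three], by linarith [Real.pi_gt_three]⟩)

lemma exists_ball_subset_re_expMap_neg (hlam : lam ≠ 0) (w : ℂ) :
    ∃ b, ball b 1 ⊆ ball w 8 ∧ ∀ y ∈ ball b 1, (expMap lam y).re < 0 := by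
  obtain ⟨θ, hθ, hexp⟩ := exists_expMap_add_mul_I lam w
  refine ⟨w + θ * Complex.I, ball_subset_ball' ?_, fun y hy ↦ ?_⟩
  · rw [dist_eq_norm, add_sub_cancel_left, norm_mul, Complex.norm_I, mul_one, Complex.norm_real,
      Real.norm_eq_abs]
    linarith [Real.pi_lt_d2]
  · rw [← add_sub_cancel (w + θ * Complex.I) y, hexp, ← Complex.ofReal_neg,
      Complex.re_ofReal_mul]
    exact mul_neg_of_neg_of_pos (neg_lt_zero.2 (norm_pos_iff.2 (expMap_ne_zero hlam w)))
      (re_exp_pos (mem_ball_iff_norm.1 hy).le)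

lemma pow_le_norm_deriv_iterate {c : ℝ} (hc : 0 ≤ c) {z : ℂ}
    (hz : ∀ n, c ≤ ‖(expMap lam)^[n] z‖) (n : ℕ) : c ^ n ≤ ‖deriv (expMap lam)^[n] z‖ := by
  induction n with
  | zero => simp
  | succ n ih =>
    rw [deriv_iterate_succ, norm_mul, pow_succ', ← Function.iterate_succ_apply' (expMap lam)]
    exact mul_le_mul (hz (n + 1)) ih (by positivity) (norm_nonneg _)

lemma measurableSet_forall_le_re (lam : ℂ) (R : ℝ) :
    MeasurableSet {z : ℂ | ∀ n, R ≤ ((expMap lam)^[n] z).re} := by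
  rw [ofPred_forall]
  exact MeasurableSet.iInter fun n ↦ measurableSet_le measurable_const
    (Complex.measurable_re.comp (measurable_iterate lam n))

lemma exists_inverseBranch_norm_deriv_lt (hlam : lam ≠ 0) {ρ R D : ℝ} (hD : 0 < D)
    (hPρ : ∀ z ∈ postOrbit lam, ‖z‖ ≤ ρ) (hR : ρ + D ≤ R) (hR2 : 2 ≤ R) {z : ℂ}
    (hz : ∀ n, R ≤ ((expMap lam)^[n] z).re) {ε : ℝ} (hε : 0 < ε) :
    ∃ n φ, IsInverseBranch (expMap lam)^[n] φ ((expMap lam)^[n] z) D ∧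
      φ ((expMap lam)^[n] z) = z ∧ ‖deriv φ ((expMap lam)^[n] z)‖ < ε := by
  obtain ⟨n, hn⟩ := pow_unbounded_of_one_lt (1 / ε) one_lt_two
  have hgrow : 2 ^ n ≤ ‖deriv (expMap lam)^[n] z‖ :=
    pow_le_norm_deriv_iterate zero_le_two
      (fun k ↦ (hR2.trans (hz k)).trans (Complex.re_le_norm _)) n
  have hcenter := mem_ball_self (x := (expMap lam)^[n] z) hD
  obtain ⟨φ, hφ, hφz⟩ := exists_inverseBranch hlam
    (disjoint_ball_postOrbit_of_le_re hPρ (hR.trans (hz n))) n hcenter rfl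
  have hinv := hφ.norm_deriv_mul (differentiable_iterate lam n) hcenter
  rw [hφz] at hinv
  refine ⟨n, φ, hφ, hφz, ?_⟩
  have hlarge : 1 / ε < ‖deriv (expMap lam)^[n] z‖ := hn.trans_le hgrow
  have hpos : 0 < ‖deriv (expMap lam)^[n] z‖ := (one_div_pos.2 hε).trans hlarge
  rw [div_lt_iff₀ hε] at hlarge
  refine lt_of_mul_lt_mul_left (a := ‖deriv (expMap lam)^[n] z‖) ?_ hpos.le
  linarith

-- At a density point the set would, after blowing up, nearly fill balls of radius `8` around
-- `fⁿ z`; but each of them contains a unit ball that `f` maps into the left half-plane.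
lemma volume_forall_le_re_eq_zero (hlam : lam ≠ 0) {ρ R : ℝ}
    (hPρ : ∀ z ∈ postOrbit lam, ‖z‖ ≤ ρ) (hR : ρ + 2 * 8 ≤ R) (hR2 : 2 ≤ R) :
    volume {z : ℂ | ∀ n, R ≤ ((expMap lam)^[n] z).re} = 0 := by
  by_contra hpos
  have hmeas := measurableSet_forall_le_re lam R
  obtain ⟨z, hzR, hz⟩ := exists_mem_tendsto_density hmeas hpos
  obtain ⟨ε, hε, hdens⟩ := exists_image_inter_nonempty hmeas hz le_rfl (D := 8) (by norm_num)
    (measure_ball_pos volume (0 : ℂ) one_pos).ne'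
  obtain ⟨n, φ, hφ, hφz, hφε⟩ :=
    exists_inverseBranch_norm_deriv_lt hlam (by norm_num) hPρ hR hR2 hzR hε
  obtain ⟨b, hb, hneg⟩ := exists_ball_subset_re_expMap_neg hlam ((expMap lam)^[n] z)
  obtain ⟨_, ⟨y, hy, rfl⟩, hyR⟩ := hdens _ φ _ (differentiable_iterate lam n) hφ (by simp [hφz])
    hφε _ hb measurableSet_ball (Measure.addHaar_ball_center volume b 1).ge
  have hle : R ≤ ((expMap lam)^[n + 1] (φ y)).re := hyR (n + 1)
  rw [Function.iterate_succ_apply', hφ.right_inv y (ball_subset_ball (by norm_num) (hb hy))] at hle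
  linarith [hneg y hy]

lemma volume_escaping_eq_zero (hlam : lam ≠ 0)
    (hb : Bornology.IsBounded (forwardOrbit (expMap lam) 0)) :
    volume {z : ℂ | Tendsto (fun n ↦ ‖(expMap lam)^[n] z‖) atTop atTop} = 0 := by
  obtain ⟨ρ, hρ, hPρ⟩ := exists_norm_bound hb
  set R := ρ + 2 * 8
  have hnull := volume_forall_le_re_eq_zero hlam hPρ le_rfl (show 2 ≤ R by linarith)
  refine measure_mono_null (fun z (hz : Tendsto _ _ _) ↦ ?_) (measure_iUnion_null fun N ↦
    volume_preimage_iterate_eq_zero hlam (measurableSet_forall_le_re lam R) hnull N)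
  obtain ⟨N, hN⟩ := eventually_atTop.1 (hz.eventually_ge_atTop (‖lam‖ * Real.exp R))
  refine mem_iUnion.2 ⟨N, fun n ↦ ?_⟩
  have hlarge := hN (n + N + 1) (by lia)
  rw [Function.iterate_succ_apply', norm_expMap] at hlarge
  rw [← Function.iterate_add_apply]
  exact Real.exp_le_exp.1 (le_of_mul_le_mul_left hlarge (norm_pos_iff.2 hlam))

/-! ### Normality and recurrence -/

lemma exists_lt_norm_deriv_iterate_of_mem_ball (hlam : lam ≠ 0)
    (hb : Bornology.IsBounded (forwardOrbit (expMap lam) 0))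
    (hconn : IsPreconnected (postOrbit lam)ᶜ) {p : ℂ} {r : ℝ} (hr : 0 < r)
    (hd : Disjoint (ball p (2 * r)) (postOrbit lam)) (x : ℂ) (M : ℝ) :
    ∃ N, ∀ n ≥ N, (expMap lam)^[n] x ∈ ball p r → M < ‖deriv (expMap lam)^[n] x‖ := by
  have hp : p ∉ postOrbit lam := disjoint_left.1 hd (mem_ball_self (by positivity))
  obtain ⟨K, hK, hcomp⟩ := pullbackComparable_ball hlam hr hd (mem_ball_self hr)
  obtain ⟨N, hN⟩ := exists_lt_norm_deriv_iterate hlam hb hconn hp (K * M)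
    (‖x‖ + K / (2 * r / 640))
  refine ⟨max N 1, fun n hn hnx ↦ ?_⟩
  obtain ⟨w, hw, hwx, hder⟩ := hcomp _ hnx n x rfl
  have hlow := le_norm_deriv_iterate hlam (by positivity) hd ((le_max_right _ _).trans hn) hw
  have hdist : ‖w - x‖ ≤ K / (2 * r / 640) := by
    rw [le_div_iff₀ (by positivity)]
    exact le_trans (by gcongr) hwx
  have hlarge := hN n ((le_max_left _ _).trans hn) w hw
    (by linarith [norm_le_norm_add_norm_sub' w x])
  exact lt_of_mul_lt_mul_left (hlarge.trans_le hder) hK.le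

lemma not_iteratesNormalOn_of_tendsto_norm_deriv {f : ℂ → ℂ} (hf : Differentiable ℂ f)
    {U : Set ℂ} (hU : IsOpen U) {x : ℂ} (hx : x ∈ U) {n : ℕ → ℕ} {C : ℝ}
    (hC : ∀ j, ‖f^[n j] x‖ ≤ C)
    (hn : Tendsto (fun j ↦ ‖deriv f^[n j] x‖) atTop atTop) : ¬ IteratesNormalOn f U := by
  intro hnormal
  obtain ⟨k, hk, ⟨g, hg⟩ | hinfty⟩ := hnormal n
  · have hderiv := (hg.deriv (Eventually.of_forall fun j ↦
      (hf.iterate (n (k j))).differentiableOn) hU).tendsto_at hx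
    exact not_tendsto_nhds_of_tendsto_atTop (hn.comp hk.tendsto_atTop) _ hderiv.norm
  · obtain ⟨j, hj⟩ := (hinfty {x} (singleton_subset_iff.2 hx) isCompact_singleton C).exists
    exact (hj x rfl).not_ge (hC (k j))

lemma not_iteratesNormalOn_of_mapClusterPt (hlam : lam ≠ 0)
    (hb : Bornology.IsBounded (forwardOrbit (expMap lam) 0))
    (hconn : IsPreconnected (postOrbit lam)ᶜ) {x p : ℂ} (hp : p ∉ postOrbit lam)
    (hx : MapClusterPt p atTop fun n ↦ (expMap lam)^[n] x) {U : Set ℂ} (hU : IsOpen U)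
    (hxU : x ∈ U) : ¬ IteratesNormalOn (expMap lam) U := by
  obtain ⟨r, hr, hd⟩ := exists_ball_disjoint_postOrbit hp
  obtain ⟨n, hn, hnx⟩ := extraction_of_frequently_atTop
    (mapClusterPt_iff_frequently.1 hx _ (ball_mem_nhds p hr))
  refine not_iteratesNormalOn_of_tendsto_norm_deriv (differentiable_expMap lam) hU hxU
    (n := n) (C := ‖p‖ + r) (fun j ↦ ?_) (tendsto_atTop.2 fun M ↦ ?_)
  · linarith [norm_le_norm_add_norm_sub' ((expMap lam)^[n j] x) p, mem_ball_iff_norm.1 (hnx j)]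
  · obtain ⟨N, hN⟩ := exists_lt_norm_deriv_iterate_of_mem_ball hlam hb hconn hr hd x M
    filter_upwards [hn.tendsto_atTop.eventually_ge_atTop N] with j hj
    exact (hN (n j) hj (hnx j)).le

/-! ### The parameter `2πi` -/

/-- The parameter `2πi`, a fixed point of its own exponential map; it is kept as a constant so that
it is not unfolded inside the iterates. -/
noncomputable def tau : ℂ := 2 * Real.pi * Complex.I

lemma norm_tau : ‖tau‖ = 2 * Real.pi := by simp [tau, abs_of_pos Real.pi_pos]

lemma tau_ne_zero : tau ≠ 0 := by simp [tau, Real.pi_ne_zero]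

lemma exp_tau : Complex.exp tau = 1 := Complex.exp_two_pi_mul_I

lemma expMap_tau_zero : expMap tau 0 = tau := by simp [expMap]

lemma isFixedPt_tau : Function.IsFixedPt (expMap tau) tau := by
  rw [Function.IsFixedPt, expMap, exp_tau, mul_one]

lemma forwardOrbit_tau : forwardOrbit (expMap tau) 0 = {0, tau} := by
  have hsucc (n : ℕ) : (expMap tau)^[n + 1] 0 = tau := by
    rw [Function.iterate_succ_apply, expMap_tau_zero, isFixedPt_tau.iterate n]
  ext z
  constructor
  · rintro ⟨_ | n, rfl⟩
    · exact Or.inl rfl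
    · exact Or.inr (hsucc n)
  · rintro (rfl | rfl)
    · exact ⟨0, rfl⟩
    · exact ⟨1, hsucc 0⟩

lemma postOrbit_tau : postOrbit tau = {0, tau} := by
  rw [postOrbit, forwardOrbit_tau]
  exact (Set.toFinite _).isClosed.closure_eq

lemma isBounded_forwardOrbit_tau : Bornology.IsBounded (forwardOrbit (expMap tau) 0) := by
  rw [forwardOrbit_tau]
  exact (Set.toFinite _).isBounded

lemma isPreconnected_compl_postOrbit_tau : IsPreconnected (postOrbit tau)ᶜ := by
  rw [postOrbit_tau]
  exact ((Set.toFinite _).countable.isConnected_compl_of_one_lt_rank (by simp)).isPreconnected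

lemma norm_expMap_tau_sub (z : ℂ) :
    ‖expMap tau z - tau‖ = 2 * Real.pi * ‖Complex.exp (z - tau) - 1‖ := by
  rw [← norm_tau, ← norm_mul, Complex.exp_sub, exp_tau, expMap, div_one, mul_sub, mul_one]

lemma three_mul_norm_sub_tau_le {z : ℂ} (hz : ‖z - tau‖ ≤ 1 / 2) :
    3 * ‖z - tau‖ ≤ ‖expMap tau z - tau‖ := by
  set h := z - tau
  have htaylor := Complex.norm_exp_sub_one_sub_id_le (x := h) (by linarith)
  have htri := norm_sub_norm_le h (h - (Complex.exp h - 1))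
  rw [sub_sub_cancel, norm_sub_rev h] at htri
  have hsq : ‖h‖ ^ 2 ≤ ‖h‖ / 2 := by nlinarith [norm_nonneg h]
  have hhalf : ‖h‖ / 2 ≤ ‖Complex.exp h - 1‖ := by linarith
  rw [norm_expMap_tau_sub]
  nlinarith [Real.pi_gt_three, norm_nonneg h, hhalf]

lemma norm_expMap_tau_sub_le {z : ℂ} (hz : ‖z - tau‖ ≤ 1 / 2) : ‖expMap tau z - tau‖ ≤ 5 := by
  set h := z - tau
  have htaylor := Complex.norm_exp_sub_one_sub_id_le (x := h) (by linarith)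
  have htri := norm_add_le (Complex.exp h - 1 - h) h
  rw [sub_add_cancel] at htri
  have hbound : ‖Complex.exp h - 1‖ ≤ 3 / 4 := by nlinarith [norm_nonneg h]
  rw [norm_expMap_tau_sub]
  nlinarith [Real.pi_lt_d2, norm_nonneg (Complex.exp h - 1)]

lemma exists_iterate_notMem_ball_tau {w : ℂ} (hw : w ≠ tau) :
    ∃ k, (expMap tau)^[k] w ∉ ball tau (1 / 2) := by
  by_contra! hall
  have hgrow (k : ℕ) : 3 ^ k * ‖w - tau‖ ≤ ‖(expMap tau)^[k] w - tau‖ := by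
    induction k with
    | zero => simp
    | succ k ih =>
      have hstep := three_mul_norm_sub_tau_le (mem_ball_iff_norm.1 (hall k)).le
      rw [Function.iterate_succ_apply', pow_succ]
      linarith
  have hpos : 0 < ‖w - tau‖ := norm_pos_iff.2 (sub_ne_zero.2 hw)
  obtain ⟨k, hk⟩ := pow_unbounded_of_one_lt (1 / ‖w - tau‖) (show (1 : ℝ) < 3 by norm_num)
  rw [div_lt_iff₀ hpos] at hk
  linarith [hgrow k, mem_ball_iff_norm.1 (hall k)]

lemma exists_iterate_mem_annulus {w : ℂ} (hw : w ≠ tau) (hwB : w ∈ ball tau (1 / 2)) :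
    ∃ k, (expMap tau)^[k] w ∈ closedBall tau 5 \ ball tau (1 / 2) := by
  classical
  have hexit := exists_iterate_notMem_ball_tau hw
  obtain ⟨l, hl⟩ := Nat.exists_eq_succ_of_ne_zero
    (show Nat.find hexit ≠ 0 from (Nat.find_pos hexit).2 (not_not.2 hwB) |>.ne')
  refine ⟨Nat.find hexit, ?_, Nat.find_spec hexit⟩
  have hlB : (expMap tau)^[l] w ∈ ball tau (1 / 2) := not_not.1 (Nat.find_min hexit (by lia))
  rw [hl, Function.iterate_succ_apply', mem_closedBall_iff_norm]
  exact norm_expMap_tau_sub_le (mem_ball_iff_norm.1 hlB).le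

lemma frequently_mem_of_mapClusterPt_postOrbit_tau {z p : ℂ} (hp : p ∈ postOrbit tau)
    (hz : MapClusterPt p atTop fun n ↦ (expMap tau)^[n] z) :
    ∃ᶠ n in atTop, (expMap tau)^[n] z ∈ ball tau (1 / 2) := by
  have hball : ball tau (1 / 2) ∈ 𝓝 tau := ball_mem_nhds tau (by norm_num)
  rw [mapClusterPt_iff_frequently] at hz
  rw [postOrbit_tau] at hp
  rcases hp with rfl | rfl
  · have hpre := (differentiable_expMap tau).continuous.continuousAt.preimage_mem_nhds
      (x := (0 : ℂ)) (by rwa [expMap_tau_zero])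
    refine (tendsto_add_atTop_nat 1).frequently ((hz _ hpre).mono fun n hn ↦ ?_)
    rwa [Function.iterate_succ_apply']
  · exact hz _ hball

-- Whenever the orbit comes close to `2πi` it is pushed away again, but only as far as the compact
-- annulus `1/2 ≤ |z - 2πi| ≤ 5`, which is disjoint from the post-singular set `{0, 2πi}`.
lemma exists_mapClusterPt_of_frequently_mem_ball_tau {z : ℂ}
    (hz : ∀ n, (expMap tau)^[n] z ≠ tau)
    (hfreq : ∃ᶠ n in atTop, (expMap tau)^[n] z ∈ ball tau (1 / 2)) :
    ∃ q ∉ postOrbit tau, MapClusterPt q atTop fun n ↦ (expMap tau)^[n] z := by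
  have hannulus : ∃ᶠ n in atTop, (expMap tau)^[n] z ∈ closedBall tau 5 \ ball tau (1 / 2) := by
    rw [frequently_atTop] at hfreq ⊢
    intro N
    obtain ⟨m, hm, hmB⟩ := hfreq N
    obtain ⟨k, hk⟩ := exists_iterate_mem_annulus (hz m) hmB
    exact ⟨k + m, by lia, by rwa [Function.iterate_add_apply]⟩
  obtain ⟨q, hqK, hq⟩ := ((isCompact_closedBall tau 5).diff
    isOpen_ball).exists_mapClusterPt_of_frequently hannulus
  refine ⟨q, fun hqP ↦ ?_, hq⟩
  rw [postOrbit_tau] at hqP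
  rcases hqP with rfl | rfl
  · have hle := mem_closedBall_iff_norm.1 hqK.1
    rw [zero_sub, norm_neg, norm_tau] at hle
    linarith [Real.pi_gt_three]
  · exact hqK.2 (mem_ball_self (by norm_num))

lemma exists_mapClusterPt_of_not_tendsto_norm {z : ℂ} (hz : ∀ n, (expMap tau)^[n] z ≠ tau)
    (hbdd : ¬ Tendsto (fun n ↦ ‖(expMap tau)^[n] z‖) atTop atTop) :
    ∃ q ∉ postOrbit tau, MapClusterPt q atTop fun n ↦ (expMap tau)^[n] z := by
  rw [Filter.tendsto_atTop] at hbdd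
  push Not at hbdd
  obtain ⟨R, hR⟩ := hbdd
  have hfreq : ∃ᶠ n in atTop, (expMap tau)^[n] z ∈ closedBall (0 : ℂ) R :=
    hR.mono fun n hn ↦ mem_closedBall_zero_iff.2 hn.le
  obtain ⟨p, -, hp⟩ := (isCompact_closedBall (0 : ℂ) R).exists_mapClusterPt_of_frequently hfreq
  by_cases hpP : p ∈ postOrbit tau
  · exact exists_mapClusterPt_of_frequently_mem_ball_tau hz
      (frequently_mem_of_mapClusterPt_postOrbit_tau hpP hp)
  · exact ⟨p, hpP, hp⟩

lemma volume_omegaLimitSet_tau_subset :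
    volume {z : ℂ | omegaLimitSet (expMap tau) z ⊆ postSingularSet tau} = 0 := by
  refine measure_mono_null (t := (⋃ n, (expMap tau)^[n] ⁻¹' {tau}) ∪
    {z : ℂ | Tendsto (fun n ↦ ‖(expMap tau)^[n] z‖) atTop atTop}) (fun z hz ↦ ?_)
    (measure_union_null (measure_iUnion_null fun n ↦ volume_preimage_iterate_eq_zero tau_ne_zero
      (measurableSet_singleton _) (measure_singleton _) n)
      (volume_escaping_eq_zero tau_ne_zero isBounded_forwardOrbit_tau))
  by_contra hmem
  rw [mem_union, not_or, mem_iUnion, not_exists] at hmem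
  exact not_omegaLimitSet_subset_iff.2
    (exists_mapClusterPt_of_not_tendsto_norm hmem.1 hmem.2) hz

lemma admissible_tau : Admissible tau where
  ne_zero := tau_ne_zero
  julia_eq := by
    refine eq_univ_of_forall fun z ↦ ?_
    rintro ⟨U, hU, hzU, hnormal⟩
    obtain ⟨x, hxU, hx⟩ : ∃ x ∈ U, ¬ omegaLimitSet (expMap tau) x ⊆ postSingularSet tau := by
      by_contra! hall
      exact (hU.measure_pos volume ⟨z, hzU⟩).ne'
        (measure_mono_null hall volume_omegaLimitSet_tau_subset)
    obtain ⟨p, hp, hxp⟩ := not_omegaLimitSet_subset_iff.1 hx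
    exact not_iteratesNormalOn_of_mapClusterPt tau_ne_zero isBounded_forwardOrbit_tau
      isPreconnected_compl_postOrbit_tau hp hxp hU hxU hnormal
  orbit_bounded := isBounded_forwardOrbit_tau
  pos_measure := by
    have hae : ∀ᵐ z : ℂ, ¬ omegaLimitSet (expMap tau) z ⊆ postSingularSet tau := by
      rw [ae_iff]
      simpa only [not_not] using volume_omegaLimitSet_tau_subset
    exact pos_iff_ne_zero.2 (frequently_ae_iff.1 hae.frequently)

end ExpDynamics

theorem theorem1_general :
    (∀ lam : ℂ, lam ≠ 0 →
      0 < volume {z : ℂ | ¬ ExpDynamics.omegaLimitSet (ExpDynamics.expMap lam) z ⊆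
        ExpDynamics.postSingularSet lam} →
      ∃ μ : Measure ℂ, SigmaFinite μ ∧ ExpDynamics.IsACInvariant (ExpDynamics.expMap lam) μ) ∧
    (∀ lam : ℂ, ExpDynamics.Admissible lam →
      ¬ ∃ μ : Measure ℂ, IsProbabilityMeasure μ ∧
          ExpDynamics.IsACInvariant (ExpDynamics.expMap lam) μ) ∧
    ExpDynamics.Admissible (2 * Real.pi * Complex.I) := by
  refine ⟨fun lam hlam hpos ↦ ExpDynamics.exists_sigmaFinite_isACInvariant hlam hpos,
    fun lam h ↦ ?_, ExpDynamics.admissible_tau⟩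
  obtain ⟨a, r, hr, hd, hE⟩ := ExpDynamics.exists_recurrentSet_ne_zero h.pos_measure
  have hconn := ExpDynamics.isPreconnected_compl_postOrbit h.julia_eq h.orbit_bounded
  exact ExpDynamics.not_exists_isACInvariant_probability h.ne_zero h.orbit_bounded hconn
    (ExpDynamics.volume_postOrbit_eq_zero h.ne_zero h.orbit_bounded hconn hr hd hE)

theorem theorem1 :
    (∀ lam : ℂ, ExpDynamics.Admissible lam →
      (∃ μ : Measure ℂ, SigmaFinite μ ∧ ExpDynamics.IsACInvariant (ExpDynamics.expMap lam) μ) ∧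
      ¬ ∃ μ : Measure ℂ, IsProbabilityMeasure μ ∧
          ExpDynamics.IsACInvariant (ExpDynamics.expMap lam) μ) ∧
    ExpDynamics.Admissible (2 * Real.pi * Complex.I) := by
  obtain ⟨hsigma, hprob, htau⟩ := theorem1_general
  exact ⟨fun lam h ↦ ⟨hsigma lam h.ne_zero h.pos_measure, hprob lam h⟩, htau⟩
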